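/- Let $g:[0,1]\to\mathbb{R}$ be a function of bounded variation with $g(0)=g(1)=0$. Put $\hat g(u)=-g(1-u)$ for $u\in[0,1]$, let $\hat g_*$ be the convex envelope of $\hat g$ on $[0,1]$ (the pointwise supremum of all convex functions on $[0,1]$ that are $\le\hat g$), and let $(\hat g_*)'$ be its right derivative on $(0,1)$. Let $\mu\in\mathbb{R}$ and $\sigma\ge 0$, and let $(\Omega,\mathcal F,P)$ be an atomless probability space. Denote by $V_U(\mu,\sigma)$ the set of random variables $X$ on it with mean $\mu$ and variance $\sigma^2$ that are unimodal, i.e. for some $x_0\in\mathbb{R}$ the distribution function of $X$ is convex on $(-\infty,x_0)$ and concave on $(x_0,\infty)$; write $\overline F_X(x)=P(X>x)$. Then, in the extended reals with $0\cdot(\pm\infty)=0$, $$\sigma\,\max\Big\{\sup_{b\in[0,1)}\Lambda_R(b),\ \sup_{b\in(0,1]}\Lambda_L(b)\Big\}\ \le\ \sup_{X\in V_U(\mu,\sigma)}\int_{-\infty}^{+\infty} g(\overline F_X(x))\,\mathrm dx\ \le\ \frac{\sigma}{3}\,\Theta ,$$ where the supremum in the middle runs over those $X\in V_U(\mu,\sigma)$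 for which the integral is well defined in $[-\infty,+\infty]$, $$\Lambda_R(b)=\frac{2b\,\hat g(b)+2\int_b^1 u\,\mathrm d\hat g(u)}{\sqrt{(1-b)^3(1/3+b)}},\qquad \Lambda_L(b)=\frac{2\sqrt3\left(-b\,\hat g(b)+\int_0^b u\,\mathrm d\hat g(u)\right)}{\sqrt{b^3(4-3b)}}$$ with Riemann--Stieltjes integrals, and $$\Theta=\int_{(0,1/2]}\sqrt{u(8-9u)}\,\mathrm d(\hat g_*)'(u)+\int_{(1/2,1)}\sqrt{(9u-1)(1-u)}\,\mathrm d(\hat g_*)'(u)\in[0,\infty],$$ (Lebesgue--Stieltjes integrals) if $\hat g_*$ is continuous at $0$ and at $1$. If $\hat g_*$ jumps at $0$ or at $1$, so that its derivative jumps there by an infinite amount, then $\Theta=+\infty$. -/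

import Mathlib

open Set MeasureTheory ProbabilityTheory

noncomputable section

namespace UnimodalEntropy

/-! ### Distortion functions and the Riemann-Stieltjes integral -/

/-- Distortion functions on `[0,1]`: bounded variation, and value `0` at `0`. Only the values on
`[0,1]` matter in everything below. -/
def IsDistortion (g : ℝ → ℝ) : Prop :=
  BoundedVariationOn g (Icc 0 1) ∧ g 0 = 0

/-- `gHat g u = -g (1 - u)`. -/
def gHat (g : ℝ → ℝ) (u : ℝ) : ℝ := -g (1 - u)

/-- `I` is the Riemann-Stieltjes integral of `f` with respect to `w` over `[a,b]`: the limit of the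
tagged sums `∑ f (ξ i) (w (t (i+1)) - w (t i))` as the mesh of the partition
`a = t 0 ≤ ξ 0 ≤ t 1 ≤ ξ 1 ≤ ⋯ ≤ t n = b` tends to zero. -/
def IsRSIntegral (f w : ℝ → ℝ) (a b I : ℝ) : Prop :=
  ∀ ε > 0, ∃ δ > 0, ∀ (n : ℕ) (t ξ : ℕ → ℝ), t 0 = a → t n = b →
    (∀ i < n, t i ≤ ξ i ∧ ξ i ≤ t (i + 1) ∧ t (i + 1) - t i < δ) →
    |∑ i ∈ Finset.range n, f (ξ i) * (w (t (i + 1)) - w (t i)) - I| < ε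

theorem IsRSIntegral.unique {f w : ℝ → ℝ} {a b I J : ℝ} (hab : a ≤ b)
    (hI : IsRSIntegral f w a b I) (hJ : IsRSIntegral f w a b J) : I = J := by
  by_contra hne
  have hpos : 0 < |I - J| / 2 := by
    have := abs_pos.2 (sub_ne_zero.2 hne)
    positivity
  obtain ⟨δ₁, h₁, H₁⟩ := hI _ hpos
  obtain ⟨δ₂, h₂, H₂⟩ := hJ _ hpos
  obtain ⟨n, hn⟩ := exists_nat_gt ((b - a) / min δ₁ δ₂)
  have hm : 0 < min δ₁ δ₂ := lt_min h₁ h₂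
  have hn' : b - a < (n + 1 : ℝ) * min δ₁ δ₂ := by
    rw [div_lt_iff₀ hm] at hn
    nlinarith
  have hn0 : (0 : ℝ) < n + 1 := by positivity
  have hstep : (b - a) / (n + 1) < min δ₁ δ₂ := by
    rw [div_lt_iff₀ hn0]
    linarith
  have hs0 : 0 ≤ (b - a) / (n + 1) := div_nonneg (by linarith) hn0.le
  let t : ℕ → ℝ := fun i => a + i * ((b - a) / (n + 1))
  have ht0 : t 0 = a := by simp [t]
  have htn : t (n + 1) = b := by
    simp only [t]
    push_cast
    field_simp
    ring
  have hd : ∀ i, t (i + 1) - t i = (b - a) / (n + 1) := by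
    intro i
    simp only [t]
    push_cast
    ring
  have A := H₁ (n + 1) t t ht0 htn (fun i _ => ⟨le_rfl, by linarith [hd i], by
    rw [hd i]; exact hstep.trans_le (min_le_left _ _)⟩)
  have B := H₂ (n + 1) t t ht0 htn (fun i _ => ⟨le_rfl, by linarith [hd i], by
    rw [hd i]; exact hstep.trans_le (min_le_right _ _)⟩)
  rw [abs_lt] at A B
  have C : |I - J| < |I - J| := by
    rw [abs_lt]
    constructor <;> linarith [A.1, A.2, B.1, B.2]
  exact lt_irrefl _ C

open Classical in
/-- The Riemann-Stieltjes integral `∫_a^b f dw` (and `0` if it does not exist; it always exists when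
`f` is continuous and `w` has bounded variation on `[a,b]`). -/
def rsIntegral (f w : ℝ → ℝ) (a b : ℝ) : ℝ :=
  if h : ∃ I, IsRSIntegral f w a b I then h.choose else 0

theorem rsIntegral_eq {f w : ℝ → ℝ} {a b I : ℝ} (hab : a ≤ b) (h : IsRSIntegral f w a b I) :
    rsIntegral f w a b = I := by
  have hex : ∃ I, IsRSIntegral f w a b I := ⟨I, h⟩
  rw [rsIntegral, dif_pos hex]
  exact hex.choose_spec.unique hab h

/-! ### The lower bound -/

/-- `Λ_R(b)`, for `0 ≤ b < 1`. -/
def LambdaR (g : ℝ → ℝ) (b : ℝ) : ℝ :=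
  (2 * b * gHat g b + 2 * rsIntegral (fun u => u) (gHat g) b 1) /
    √((1 - b) ^ 3 * (1 / 3 + b))

/-- `Λ_L(b)`, for `0 < b ≤ 1`. -/
def LambdaL (g : ℝ → ℝ) (b : ℝ) : ℝ :=
  2 * √3 * (-b * gHat g b + rsIntegral (fun u => u) (gHat g) 0 b) /
    √(b ^ 3 * (4 - 3 * b))

/-- The supremum, in the extended reals, of all values of `Λ_R` and `Λ_L`. The points `b = 1` for
`Λ_R` and `b = 0` for `Λ_L`, where the quotient is `0 / 0`, are left out. -/
def supLambda (g : ℝ → ℝ) : EReal :=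
  max (⨆ b ∈ Ico (0 : ℝ) 1, (LambdaR g b : EReal)) (⨆ b ∈ Ioc (0 : ℝ) 1, (LambdaL g b : EReal))

/-! ### The upper bound -/

/-- The convex envelope on `[0,1]`: the pointwise supremum of all convex minorants of `f`. -/
def convexEnvelope (f : ℝ → ℝ) (u : ℝ) : ℝ :=
  sSup {y | ∃ h : ℝ → ℝ, ConvexOn ℝ (Icc 0 1) h ∧ (∀ v ∈ Icc (0 : ℝ) 1, h v ≤ f v) ∧ y = h u}

theorem convexOn_convexEnvelope {f : ℝ → ℝ} {m : ℝ} (hm : ∀ v ∈ Icc (0 : ℝ) 1, m ≤ f v) :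
    ConvexOn ℝ (Icc 0 1) (convexEnvelope f) := by
  refine ⟨convex_Icc 0 1, ?_⟩
  intro x hx y hy a b ha hb hab
  have hbdd : ∀ z ∈ Icc (0 : ℝ) 1, BddAbove {y | ∃ h : ℝ → ℝ, ConvexOn ℝ (Icc 0 1) h ∧
      (∀ v ∈ Icc (0 : ℝ) 1, h v ≤ f v) ∧ y = h z} := by
    rintro z hz
    refine ⟨f z, ?_⟩
    rintro _ ⟨h, -, hle, rfl⟩
    exact hle z hz
  refine csSup_le ⟨m, fun _ => m, convexOn_const m (convex_Icc 0 1), hm, rfl⟩ ?_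
  rintro _ ⟨h, hc, hle, rfl⟩
  have h1 : h x ≤ convexEnvelope f x := le_csSup (hbdd x hx) ⟨h, hc, hle, rfl⟩
  have h2 : h y ≤ convexEnvelope f y := le_csSup (hbdd y hy) ⟨h, hc, hle, rfl⟩
  refine (hc.2 hx hy ha hb hab).trans ?_
  simp only [smul_eq_mul]
  exact add_le_add (mul_le_mul_of_nonneg_left h1 ha) (mul_le_mul_of_nonneg_left h2 hb)

/-- The right derivative. -/
def rightDeriv (f : ℝ → ℝ) (u : ℝ) : ℝ := derivWithin f (Ioi u) u

theorem monotone_clamp {r : ℝ → ℝ} {s t : ℝ} (hst : s ≤ t) (hr : MonotoneOn r (Icc s t)) :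
    Monotone (fun u => r (max s (min u t))) := by
  intro x y hxy
  refine hr ⟨le_max_left _ _, max_le hst (min_le_right _ _)⟩
    ⟨le_max_left _ _, max_le hst (min_le_right _ _)⟩ ?_
  exact max_le_max le_rfl (min_le_min hxy le_rfl)

open Classical in
/-- The Lebesgue-Stieltjes measure `dr` on `(s,t]` of a function `r` that is nondecreasing on
`[s,t]`, obtained by continuing `r` as a constant on either side of `[s,t]`. -/
def stieltjesOn (r : ℝ → ℝ) (s t : ℝ) : Measure ℝ :=
  if h : s ≤ t ∧ MonotoneOn r (Icc s t) then
    (monotone_clamp h.1 h.2).stieltjesFunction.measure.restrict (Ioc s t)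
  else 0

/-- The derivative of the convex envelope of a distortion function is nondecreasing on every
compact subinterval of `(0,1)`, so that the first branch of `stieltjesOn` is the relevant one. -/
theorem monotoneOn_rightDeriv_envelope {g : ℝ → ℝ} (hg : IsDistortion g) {s t : ℝ}
    (hs : 0 < s) (ht : t < 1) :
    MonotoneOn (rightDeriv (convexEnvelope (gHat g))) (Icc s t) := by
  have hm : ∀ v ∈ Icc (0 : ℝ) 1, -(eVariationOn g (Icc 0 1)).toReal ≤ gHat g v := by
    intro v hv
    have h1 : (1 - v) ∈ Icc (0 : ℝ) 1 := ⟨by linarith [hv.2], by linarith [hv.1]⟩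
    have h2 := hg.1.sub_le h1 (⟨le_rfl, zero_le_one⟩ : (0 : ℝ) ∈ Icc (0 : ℝ) 1)
    rw [hg.2] at h2
    simp only [gHat]
    linarith
  refine (convexOn_convexEnvelope hm).monotoneOn_rightDeriv.mono ?_
  rw [interior_Icc]
  exact fun x hx => ⟨hs.trans_le hx.1, hx.2.trans_lt ht⟩

/-- `∫_{(0,1/2]} √(u(8-9u)) dr(u)`, as an improper integral at `0`. -/
def thetaLeft (r : ℝ → ℝ) : ENNReal :=
  ⨆ s ∈ Ioo (0 : ℝ) (1 / 2),
    ∫⁻ u, ENNReal.ofReal √(u * (8 - 9 * u)) ∂(stieltjesOn r s (1 / 2))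

/-- `∫_{(1/2,1)} √((9u-1)(1-u)) dr(u)`, as an improper integral at `1`. -/
def thetaRight (r : ℝ → ℝ) : ENNReal :=
  ⨆ t ∈ Ioo (1 / 2 : ℝ) 1,
    ∫⁻ u, ENNReal.ofReal √((9 * u - 1) * (1 - u)) ∂(stieltjesOn r (1 / 2) t)

open Classical in
/-- `Θ`, a value in `[0,∞]`. If the convex envelope jumps at `0` or at `1`, then its derivative
jumps there by an infinite amount, and `Θ = ∞`. -/
def Theta (g : ℝ → ℝ) : EReal :=
  if ContinuousOn (convexEnvelope (gHat g)) (Icc 0 1) then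
    ((thetaLeft (rightDeriv (convexEnvelope (gHat g))) +
      thetaRight (rightDeriv (convexEnvelope (gHat g))) : ENNReal) : EReal)
  else ⊤

/-! ### Unimodal random variables and their entropy -/

section RandomVariables

variable {Ω : Type*} [MeasurableSpace Ω]

/-- An atomless measure: every event of positive measure contains one of smaller positive
measure. -/
def Atomless (P : Measure Ω) : Prop :=
  ∀ A, MeasurableSet A → 0 < P A → ∃ B ⊆ A, MeasurableSet B ∧ 0 < P B ∧ P B < P A

/-- The distribution function `F_X(x) = P(X ≤ x)`. -/
def distFun (P : Measure Ω) (X : Ω → ℝ) (x : ℝ) : ℝ := P.real {ω | X ω ≤ x}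

/-- The tail function `P(X > x)`. -/
def tailFun (P : Measure Ω) (X : Ω → ℝ) (x : ℝ) : ℝ := P.real {ω | x < X ω}

/-- Unimodality: for some mode `x₀`, the distribution function is convex on `(-∞, x₀)` and concave
on `(x₀, ∞)`. -/
def IsUnimodal (P : Measure Ω) (X : Ω → ℝ) : Prop :=
  ∃ x₀ : ℝ, ConvexOn ℝ (Iio x₀) (distFun P X) ∧ ConcaveOn ℝ (Ioi x₀) (distFun P X)

/-- The unimodal random variables with mean `μ` and (finite) variance `σ²`. -/
def unimodalClass (P : Measure Ω) (μ σ : ℝ) : Set (Ω → ℝ) :=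
  {X | Measurable X ∧ MemLp X 2 P ∧ ∫ ω, X ω ∂P = μ ∧ variance X P = σ ^ 2 ∧ IsUnimodal P X}

/-- The integral of the positive part of `x ↦ g (P(X > x))`. -/
def entropyPos (g : ℝ → ℝ) (P : Measure Ω) (X : Ω → ℝ) : ENNReal :=
  ∫⁻ x, ENNReal.ofReal (g (tailFun P X x))

/-- The integral of the negative part of `x ↦ g (P(X > x))`. -/
def entropyNeg (g : ℝ → ℝ) (P : Measure Ω) (X : Ω → ℝ) : ENNReal :=
  ∫⁻ x, ENNReal.ofReal (-g (tailFun P X x))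

/-- The integral `∫ g (P(X > x)) dx` is well defined, as an extended real number. -/
def EntropyDefined (g : ℝ → ℝ) (P : Measure Ω) (X : Ω → ℝ) : Prop :=
  entropyPos g P X ≠ ⊤ ∨ entropyNeg g P X ≠ ⊤

/-- The entropy `∫ g (P(X > x)) dx`, an extended real number. -/
def entropy (g : ℝ → ℝ) (P : Measure Ω) (X : Ω → ℝ) : EReal :=
  (entropyPos g P X : EReal) - (entropyNeg g P X : EReal)

/-- The supremum of the entropy over the unimodal random variables with mean `μ` and variance `σ²`
for which it is well defined. -/
def worstCaseEntropy (g : ℝ → ℝ) (P : Measure Ω) (μ σ : ℝ) : EReal :=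
  ⨆ X ∈ {X ∈ unimodalClass P μ σ | EntropyDefined g P X}, entropy g P X

end RandomVariables

end UnimodalEntropy

end

/-!
Write `w = gHat g`, `q` for the quantile function of a random variable `X`, and `F` for its
distribution function. The entropy is the integral of `-w (F x)`.

*Lower bound.* On an atomless probability space there is a uniform variable `U`
(`exists_uniform_of_atomless`). The variables `m + k * max (U - b) 0` and `m + k * min (U - b) 0`
are unimodal, and with `m` and `k` adapted to the mean and the variance their entropies are `σ`
times `Λ_R b` and `Λ_L b`, after an integration by parts in the Riemann-Stieltjes integral
(`rsIntegral_gHat`).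

*Upper bound.* Let `h` be the convex envelope of `w`, so that the entropy is at most the integral of
`-h (F x)`. If `h` is continuous, then `-h u = ∫ K(u,v) dh'(v)` with the Green function
`K(u,v) = min u v - u * v` (`tendsto_greenPotential`). By Tonelli's theorem it remains to bound
`∫ K(F x, v) dx ≤ ∫_v^1 q - (1 - v) ∫_0^1 q = tailGap v q` for each `v` separately, by `σ / 3` times
the integrand of `Θ`.

This is `tailGap_le`, and the only place where unimodality enters: `q` is concave on `(0,c]` and
convex on `[c,1)`, where `c` is the value of `F` at the mode. By reflection one may suppose
`c ≤ v`. Let `ρ` be the `L²` projection of `1_{(v,1)}` to the continuous piecewise linear functions with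
a single kink, at `c`. The function `1_{(v,1)} - ρ` has four intervals of constant sign, and `q`
can be interpolated by a function `ℓ` of this kind such that `q - ℓ` has the opposite signs. As
`1_{(v,1)} - ρ` is orthogonal to `ℓ` and to the constants, `tailGap v q` is at most the covariance
of `ρ` and `q`. The variance of `ρ` is a cubic polynomial in `(1 - v) / (1 - c)`. If `v ≥ 1 / 2`,
it is largest at `c = (3 * v - 1) / 2`; if `v ≤ 1 / 2`, it does not exceed the largest value for
`1 - v`. For `c < (3 * v - 1) / 2` the function `ρ` for `c = (3 * v - 1) / 2` still serves, since it
is zero to the left of its kink.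
-/

noncomputable section

namespace UnimodalEntropy

/-! ### Integration by parts for the Riemann-Stieltjes integral -/

lemma IsRSIntegral.sub {f p q : ℝ → ℝ} {a b I J : ℝ} (hp : IsRSIntegral f p a b I)
    (hq : IsRSIntegral f q a b J) : IsRSIntegral f (p - q) a b (I - J) := by
  intro ε hε
  obtain ⟨δ₁, h₁, H₁⟩ := hp (ε / 2) (half_pos hε)
  obtain ⟨δ₂, h₂, H₂⟩ := hq (ε / 2) (half_pos hε)
  refine ⟨min δ₁ δ₂, lt_min h₁ h₂, fun n t ξ h0 hn h => ?_⟩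
  have A := H₁ n t ξ h0 hn fun i hi =>
    ⟨(h i hi).1, (h i hi).2.1, (h i hi).2.2.trans_le (min_le_left _ _)⟩
  have B := H₂ n t ξ h0 hn fun i hi =>
    ⟨(h i hi).1, (h i hi).2.1, (h i hi).2.2.trans_le (min_le_right _ _)⟩
  have e : ∑ i ∈ Finset.range n, f (ξ i) * ((p - q) (t (i + 1)) - (p - q) (t i)) =
      ∑ i ∈ Finset.range n, f (ξ i) * (p (t (i + 1)) - p (t i)) -
        ∑ i ∈ Finset.range n, f (ξ i) * (q (t (i + 1)) - q (t i)) := by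
    rw [← Finset.sum_sub_distrib]
    refine Finset.sum_congr rfl fun i _ => ?_
    simp only [Pi.sub_apply]
    ring
  rw [e]
  rw [abs_lt] at A B ⊢
  constructor <;> linarith [A.1, A.2, B.1, B.2]

/-- Integration by parts for a monotone integrator. On each subinterval the tagged term differs from
the increment of `x ↦ x * p x - ∫ p` by at most the mesh times the increment of `p`. -/
lemma isRSIntegral_id_of_monotoneOn {p : ℝ → ℝ} {a b : ℝ} (hab : a ≤ b)
    (hp : MonotoneOn p (Icc a b)) :
    IsRSIntegral (fun u => u) p a b (b * p b - a * p a - ∫ u in a..b, p u) := by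
  intro ε hε
  have hpab : 0 ≤ p b - p a := sub_nonneg.2 (hp (left_mem_Icc.2 hab) (right_mem_Icc.2 hab) hab)
  refine ⟨ε / (p b - p a + 1), by positivity, fun n t ξ h0 hn h => ?_⟩
  obtain ⟨δ, hδ⟩ : ∃ δ, δ = ε / (p b - p a + 1) := ⟨_, rfl⟩
  rw [← hδ] at h
  have hδ0 : 0 < δ := by rw [hδ]; positivity
  have hstep : ∀ i < n, t i ≤ t (i + 1) := fun i hi => (h i hi).1.trans (h i hi).2.1
  have hta : ∀ i ≤ n, a ≤ t i := by
    intro i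
    induction i with
    | zero => intro _; exact h0.ge
    | succ k ih => intro hk; exact (ih (by omega)).trans (hstep k (by omega))
  have htb : ∀ i ≤ n, t (n - i) ≤ b := by
    intro i
    induction i with
    | zero => intro _; exact hn.le
    | succ k ih =>
      intro hk
      refine le_trans ?_ (ih (by omega))
      have := hstep (n - (k + 1)) (by omega)
      rwa [show n - (k + 1) + 1 = n - k by omega] at this
  have htm : ∀ i ≤ n, t i ∈ Icc a b := fun i hi => ⟨hta i hi, by
    have := htb (n - i) (by omega)
    rwa [show n - (n - i) = i by omega] at this⟩
  have hint : ∀ x ∈ Icc a b, ∀ y ∈ Icc a b, IntervalIntegrable p volume x y := fun x hx y hy =>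
    (hp.mono (uIcc_subset_Icc hx hy)).intervalIntegrable
  let F : ℝ → ℝ := fun x => x * p x - ∫ u in a..x, p u
  have ha : a ∈ Icc a b := left_mem_Icc.2 hab
  have hF : b * p b - a * p a - ∫ u in a..b, p u =
      ∑ i ∈ Finset.range n, (F (t (i + 1)) - F (t i)) := by
    rw [Finset.sum_range_sub (fun i => F (t i)), h0, hn]
    simp only [F, intervalIntegral.integral_same]
    ring
  rw [hF, ← Finset.sum_sub_distrib]
  have hterm : ∀ i ∈ Finset.range n,
      |ξ i * (p (t (i + 1)) - p (t i)) - (F (t (i + 1)) - F (t i))| ≤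
        δ * (p (t (i + 1)) - p (t i)) := by
    intro i hi
    rw [Finset.mem_range] at hi
    obtain ⟨hξ1, hξ2, hξδ⟩ := h i hi
    have m0 := htm i hi.le
    have m1 := htm (i + 1) hi
    have hle := hstep i hi
    have hsub : ∀ u ∈ Icc (t i) (t (i + 1)), u ∈ Icc a b :=
      fun u hu => ⟨m0.1.trans hu.1, hu.2.trans m1.2⟩
    have hi1 : (t (i + 1) - t i) * p (t i) ≤ ∫ u in (t i)..(t (i + 1)), p u := by
      have := intervalIntegral.integral_mono_on hle intervalIntegrable_const (hint _ m0 _ m1)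
        (fun u hu => hp m0 (hsub u hu) hu.1)
      simpa using this
    have hi2 : ∫ u in (t i)..(t (i + 1)), p u ≤ (t (i + 1) - t i) * p (t (i + 1)) := by
      have := intervalIntegral.integral_mono_on hle (hint _ m0 _ m1) intervalIntegrable_const
        (fun u hu => hp (hsub u hu) m1 hu.2)
      simpa using this
    have hadj := intervalIntegral.integral_add_adjacent_intervals (hint a ha _ m0) (hint _ m0 _ m1)
    have hinc : 0 ≤ p (t (i + 1)) - p (t i) := sub_nonneg.2 (hp m0 m1 hle)
    have k1 : (ξ i - t i) * (p (t (i + 1)) - p (t i)) ≤ δ * (p (t (i + 1)) - p (t i)) :=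
      mul_le_mul_of_nonneg_right (by linarith) hinc
    have k2 : (t (i + 1) - ξ i) * (p (t (i + 1)) - p (t i)) ≤ δ * (p (t (i + 1)) - p (t i)) :=
      mul_le_mul_of_nonneg_right (by linarith) hinc
    simp only [F]
    rw [abs_le]
    constructor <;> linarith
  refine (Finset.abs_sum_le_sum_abs _ _).trans_lt ((Finset.sum_le_sum hterm).trans_lt ?_)
  rw [← Finset.mul_sum, Finset.sum_range_sub (fun i => p (t i)), h0, hn, hδ, div_mul_eq_mul_div,
    div_lt_iff₀ (by positivity)]
  nlinarith

lemma exists_monotoneOn_gHat {g : ℝ → ℝ} (hg : IsDistortion g) :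
    ∃ p q : ℝ → ℝ, MonotoneOn p (Icc 0 1) ∧ MonotoneOn q (Icc 0 1) ∧ gHat g = p - q := by
  obtain ⟨p, q, hp, hq, hpq⟩ :=
    hg.1.locallyBoundedVariationOn.exists_monotoneOn_sub_monotoneOn
  have hm : ∀ u ∈ Icc (0 : ℝ) 1, 1 - u ∈ Icc (0 : ℝ) 1 :=
    fun u hu => ⟨by linarith [hu.2], by linarith [hu.1]⟩
  refine ⟨fun u => -p (1 - u), fun u => -q (1 - u), ?_, ?_, ?_⟩
  · exact fun x hx y hy hxy => neg_le_neg (hp (hm y hy) (hm x hx) (by linarith))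
  · exact fun x hx y hy hxy => neg_le_neg (hq (hm y hy) (hm x hx) (by linarith))
  · funext u
    simp only [gHat, hpq, Pi.sub_apply]
    ring

lemma rsIntegral_gHat {g : ℝ → ℝ} (hg : IsDistortion g) {a b : ℝ} (hab : a ≤ b) (ha : 0 ≤ a)
    (hb : b ≤ 1) : rsIntegral (fun u => u) (gHat g) a b =
      b * gHat g b - a * gHat g a - ∫ u in a..b, gHat g u := by
  obtain ⟨p, q, hp, hq, h⟩ := exists_monotoneOn_gHat hg
  have hs : Icc a b ⊆ Icc 0 1 := Icc_subset_Icc ha hb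
  have hI := (isRSIntegral_id_of_monotoneOn hab (hp.mono hs)).sub
    (isRSIntegral_id_of_monotoneOn hab (hq.mono hs))
  rw [h, rsIntegral_eq hab hI]
  simp only [Pi.sub_apply]
  rw [intervalIntegral.integral_sub]
  · ring
  · exact (hp.mono (by rwa [uIcc_of_le hab])).intervalIntegrable
  · exact (hq.mono (by rwa [uIcc_of_le hab])).intervalIntegrable

/-! ### Uniform random variables on atomless probability spaces -/

section Atomless

variable {Ω : Type*} [MeasurableSpace Ω]

/-- Strict inclusion with strictly smaller measure. Demanding the latter makes distinct members of a
chain have distinct measures, so that null sets cannot obstruct the comparison of sets. -/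
def StrictSub (P : Measure Ω) (A B : {A : Set Ω // MeasurableSet A}) : Prop :=
  A.1 ⊆ B.1 ∧ P A.1 < P B.1

/-- The members of a chain with measure below `t` have a measurable least upper bound of measure at
most `t`: the largest of them if there is one, and otherwise the union of a sequence of them whose
measures tend to the supremum. -/
lemma exists_measurableSet_top_below (P : Measure Ω) [IsProbabilityMeasure P]
    {C : Set {A : Set Ω // MeasurableSet A}} (hC : IsChain (StrictSub P) C) {t : ENNReal}
    (hne : ∃ A ∈ C, P A.1 < t) :
    ∃ U : {A : Set Ω // MeasurableSet A}, P U.1 ≤ t ∧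
      (∀ E ∈ C, P E.1 < t → E = U ∨ StrictSub P E U) ∧
      (∀ E ∈ C, t < P E.1 → StrictSub P U E) := by
  obtain ⟨a, ha⟩ : ∃ a, a = ⨆ E ∈ {E ∈ C | P E.1 < t}, P E.1 := ⟨_, rfl⟩
  have hat : a ≤ t := by rw [ha]; exact iSup₂_le fun E hE => hE.2.le
  have hle : ∀ E ∈ C, P E.1 < t → P E.1 ≤ a := fun E hE hEt => by
    rw [ha]; exact le_iSup₂ (f := fun (E : {A : Set Ω // MeasurableSet A})
      (_ : E ∈ {E ∈ C | P E.1 < t}) => P E.1) E ⟨hE, hEt⟩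
  have hcmp : ∀ E ∈ C, ∀ D ∈ C, P E.1 < P D.1 → StrictSub P E D := by
    intro E hE D hD h
    rcases hC hE hD (by rintro rfl; exact lt_irrefl _ h) with h' | h'
    · exact h'
    · exact absurd h'.2 h.not_gt
  by_cases hex : ∃ E ∈ C, P E.1 < t ∧ P E.1 = a
  · obtain ⟨E, hE, hEt, hEa⟩ := hex
    refine ⟨E, hEt.le, fun D hD hDt => ?_, fun D hD hDt => hcmp E hE D hD (hEt.trans hDt)⟩
    by_cases h : D = E
    · exact Or.inl h
    · rcases hC hD hE h with h' | h'
      · exact Or.inr h'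
      · exact absurd (hle D hD hDt) (not_le.2 (hEa ▸ h'.2))
  · push Not at hex
    have hlt : ∀ E ∈ C, P E.1 < t → P E.1 < a := fun E hE hEt =>
      lt_of_le_of_ne (hle E hE hEt) (hex E hE hEt)
    obtain ⟨E₀, hE₀, hE₀t⟩ := hne
    have ha0 : 0 < a := bot_le.trans_lt (hlt E₀ hE₀ hE₀t)
    obtain ⟨x, -, hx, hxa⟩ := exists_seq_strictMono_tendsto' ha0
    have hseq : ∀ n, ∃ E ∈ C, P E.1 < t ∧ x n < P E.1 := by
      intro n
      have : x n < ⨆ E ∈ {E ∈ C | P E.1 < t}, P E.1 := ha ▸ (hx n).2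
      simp only [lt_iSup_iff] at this
      obtain ⟨E, ⟨hE, hEt⟩, h⟩ := this
      exact ⟨E, hE, hEt, h⟩
    choose B hBC hBt hxB using hseq
    have hdir : Directed (· ⊆ ·) fun n => (B n).1 := by
      intro i j
      by_cases hij : B i = B j
      · exact ⟨i, subset_rfl, by simp only [hij]; exact subset_rfl⟩
      · rcases hC (hBC i) (hBC j) hij with h | h
        · exact ⟨j, h.1, subset_rfl⟩
        · exact ⟨i, subset_rfl, h.1⟩
    have hU : P (⋃ n, (B n).1) = a := by
      rw [hdir.measure_iUnion]
      refine le_antisymm (iSup_le fun n => hle _ (hBC n) (hBt n)) ?_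
      exact le_of_tendsto' hxa fun n => (hxB n).le.trans (le_iSup (fun n => P (B n).1) n)
    refine ⟨⟨⋃ n, (B n).1, MeasurableSet.iUnion fun n => (B n).2⟩, hU.le.trans hat, ?_, ?_⟩
    · intro E hE hEt
      right
      have h1 := hlt E hE hEt
      obtain ⟨n, hn⟩ := ((tendsto_order.1 hxa).1 _ h1).exists
      exact ⟨(hcmp E hE _ (hBC n) (hn.trans (hxB n))).1.trans (subset_iUnion (fun n => (B n).1) n),
        by simpa only [hU] using h1⟩
    · intro E hE hEt
      exact ⟨iUnion_subset fun n => (hcmp _ (hBC n) E hE ((hBt n).trans hEt)).1,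
        by simpa only [hU] using hat.trans_lt hEt⟩

lemma prob_lt_iff_compl_lt (P : Measure Ω) [IsProbabilityMeasure P] {A : Set Ω}
    (hA : MeasurableSet A) {t : ENNReal} (ht : t ≤ 1) : P A < t ↔ 1 - t < P Aᶜ := by
  have h := prob_add_prob_compl (μ := P) hA
  have hAf := measure_ne_top P A
  have hAc := measure_ne_top P Aᶜ
  have htf := ne_top_of_le_ne_top ENNReal.one_ne_top ht
  rw [← ENNReal.toReal_lt_toReal hAf htf, ← ENNReal.toReal_lt_toReal (by finiteness) hAc,
    ENNReal.toReal_sub_of_le ht ENNReal.one_ne_top]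
  have h' := congrArg ENNReal.toReal h
  rw [ENNReal.toReal_add hAf hAc] at h'
  simp only [ENNReal.toReal_one] at h' ⊢
  constructor <;> intro <;> linarith

lemma strictSub_compl_iff (P : Measure Ω) [IsProbabilityMeasure P]
    {A B : {A : Set Ω // MeasurableSet A}} :
    StrictSub P ⟨B.1ᶜ, B.2.compl⟩ ⟨A.1ᶜ, A.2.compl⟩ ↔ StrictSub P A B := by
  unfold StrictSub
  rw [compl_subset_compl, prob_lt_iff_compl_lt P A.2 prob_le_one, prob_compl_eq_one_sub B.2]

/-- The dual of `exists_measurableSet_top_below`, obtained by taking complements. -/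
lemma exists_measurableSet_bot_above (P : Measure Ω) [IsProbabilityMeasure P]
    {C : Set {A : Set Ω // MeasurableSet A}} (hC : IsChain (StrictSub P) C) {t : ENNReal}
    (ht : t ≤ 1) (hne : ∃ A ∈ C, t < P A.1) :
    ∃ U : {A : Set Ω // MeasurableSet A}, t ≤ P U.1 ∧
      (∀ E ∈ C, t < P E.1 → E = U ∨ StrictSub P U E) ∧
      (∀ E ∈ C, P E.1 < t → StrictSub P E U) := by
  let κ : {A : Set Ω // MeasurableSet A} → {A : Set Ω // MeasurableSet A} :=
    fun A => ⟨A.1ᶜ, A.2.compl⟩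
  have hκκ : ∀ A, κ (κ A) = A := fun A => Subtype.ext (compl_compl A.1)
  have hκ : ∀ A B, StrictSub P (κ B) (κ A) ↔ StrictSub P A B :=
    fun A B => strictSub_compl_iff P
  have hlt : ∀ A : {A : Set Ω // MeasurableSet A}, t < P A.1 ↔ P (κ A).1 < 1 - t := by
    intro A
    rw [prob_lt_iff_compl_lt P (κ A).2 tsub_le_self, ENNReal.sub_sub_cancel ENNReal.one_ne_top ht]
    simp [κ]
  have hlt' : ∀ A : {A : Set Ω // MeasurableSet A}, P A.1 < t ↔ 1 - t < P (κ A).1 :=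
    fun A => prob_lt_iff_compl_lt P A.2 ht
  have hC' : IsChain (StrictSub P) (κ ⁻¹' C) := by
    intro A hA B hB hAB
    rcases hC hA hB (fun h => hAB (by rw [← hκκ A, h, hκκ])) with h | h
    · exact Or.inr ((hκ _ _).1 h)
    · exact Or.inl ((hκ _ _).1 h)
  have hmem : ∀ E ∈ C, κ E ∈ κ ⁻¹' C := fun E hE => by simpa only [mem_preimage, hκκ] using hE
  obtain ⟨A, hA, hAt⟩ := hne
  obtain ⟨U, hU1, hU2, hU3⟩ := exists_measurableSet_top_below P hC' (t := 1 - t)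
    ⟨κ A, hmem A hA, (hlt A).1 hAt⟩
  refine ⟨κ U, ?_, fun E hE hEt => ?_, fun E hE hEt => ?_⟩
  · by_contra h
    push Not at h
    rw [hlt', hκκ] at h
    exact absurd hU1 (not_le.2 h)
  · rcases hU2 (κ E) (hmem E hE) ((hlt E).1 hEt) with h | h
    · exact Or.inl (by rw [← h, hκκ])
    · right
      rw [← hκ, hκκ]
      exact h
  · have := hU3 (κ E) (hmem E hE) ((hlt' E).1 hEt)
    rw [← hκ, hκκ]
    exact this

/-- A form of Sierpiński's theorem on the range of an atomless measure: the measures of a maximal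
chain fill `[0,1]`, since a gap in them could be filled with part of the difference of the two sets
adjacent to it. -/
lemma exists_chain_of_atomless (P : Measure Ω) [IsProbabilityMeasure P] (hP : Atomless P) :
    ∃ C : Set {A : Set Ω // MeasurableSet A}, IsChain (StrictSub P) C ∧
      ∀ t : ENNReal, t ≤ 1 → ∃ A ∈ C, P A.1 = t := by
  let e : {A : Set Ω // MeasurableSet A} := ⟨∅, MeasurableSet.empty⟩
  let o : {A : Set Ω // MeasurableSet A} := ⟨univ, MeasurableSet.univ⟩
  have heo : StrictSub P e o := ⟨empty_subset _, by simp [e, o]⟩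
  have h0 : IsChain (StrictSub P) {e, o} := by
    refine IsChain.insert (IsChain.singleton) ?_
    rintro b hb -
    rw [mem_singleton_iff.1 hb]
    exact Or.inl heo
  obtain ⟨C, hmax, hsub⟩ := h0.exists_maxChain
  have heC : e ∈ C := hsub (by simp)
  have hoC : o ∈ C := hsub (by simp)
  refine ⟨C, hmax.1, fun t ht => ?_⟩
  have hins : ∀ W, (∀ E ∈ C, W ≠ E → StrictSub P W E ∨ StrictSub P E W) → W ∈ C := by
    intro W hW
    have := hmax.2 (hmax.1.insert hW) (subset_insert _ _)
    rw [this]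
    exact mem_insert _ _
  by_contra hno
  push Not at hno
  have hdich : ∀ E ∈ C, P E.1 < t ∨ t < P E.1 := fun E hE => lt_or_gt_of_ne (hno E hE)
  have h0t : P e.1 < t := by
    rcases hdich e heC with h | h
    · exact h
    · simp [e] at h
  have ht1 : t < P o.1 := by
    rcases hdich o hoC with h | h
    · exact absurd ht (not_le.2 (by simpa [o] using h))
    · exact h
  obtain ⟨U, hUt, hU1, hU2⟩ := exists_measurableSet_top_below P hmax.1 ⟨e, heC, h0t⟩
  obtain ⟨V, hVt, hV1, hV2⟩ := exists_measurableSet_bot_above P hmax.1 ht ⟨o, hoC, ht1⟩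
  have hUC : U ∈ C := hins U fun E hE hne => by
    rcases hdich E hE with h | h
    · rcases hU1 E hE h with h' | h'
      · exact absurd h'.symm hne
      · exact Or.inr h'
    · exact Or.inl (hU2 E hE h)
  have hVC : V ∈ C := hins V fun E hE hne => by
    rcases hdich E hE with h | h
    · exact Or.inr (hV2 E hE h)
    · rcases hV1 E hE h with h' | h'
      · exact absurd h'.symm hne
      · exact Or.inl h'
  have hUt' : P U.1 < t := lt_of_le_of_ne hUt (hno U hUC)
  have hVt' : t < P V.1 := lt_of_le_of_ne hVt (hno V hVC).symm
  have hUV := hU2 V hVC hVt'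
  have hdiff : P (V.1 \ U.1) = P V.1 - P U.1 :=
    measure_sdiff hUV.1 U.2.nullMeasurableSet (measure_ne_top _ _)
  obtain ⟨D, hDsub, hD, hD0, hDlt⟩ := hP (V.1 \ U.1) (V.2.diff U.2) (by
    rw [hdiff]; exact tsub_pos_of_lt hUV.2)
  have hW : P (U.1 ∪ D) = P U.1 + P D :=
    measure_union (disjoint_sdiff_right.mono_right hDsub) hD
  have hUW : P U.1 < P (U.1 ∪ D) := by
    rw [hW]; exact ENNReal.lt_add_right (measure_ne_top _ _) hD0.ne'
  have hWV : P (U.1 ∪ D) < P V.1 := by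
    rw [hW, ← add_tsub_cancel_of_le hUV.2.le, ← hdiff]
    exact ENNReal.add_lt_add_left (measure_ne_top _ _) hDlt
  have hWsub : U.1 ∪ D ⊆ V.1 := union_subset hUV.1 (hDsub.trans sdiff_subset)
  have hEU : ∀ E ∈ C, P E.1 < t → E.1 ⊆ U.1 ∧ P E.1 ≤ P U.1 := fun E hE h => by
    rcases hU1 E hE h with h' | h'
    · rw [h']; exact ⟨subset_rfl, le_rfl⟩
    · exact ⟨h'.1, h'.2.le⟩
  have hVE : ∀ E ∈ C, t < P E.1 → V.1 ⊆ E.1 ∧ P V.1 ≤ P E.1 := fun E hE h => by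
    rcases hV1 E hE h with h' | h'
    · rw [h']; exact ⟨subset_rfl, le_rfl⟩
    · exact ⟨h'.1, h'.2.le⟩
  have hWC : (⟨U.1 ∪ D, U.2.union hD⟩ : {A : Set Ω // MeasurableSet A}) ∈ C :=
    hins _ fun E hE _ => by
      rcases hdich E hE with h | h
      · exact Or.inr ⟨(hEU E hE h).1.trans subset_union_left, (hEU E hE h).2.trans_lt hUW⟩
      · exact Or.inl ⟨hWsub.trans (hVE E hE h).1, hWV.trans_le (hVE E hE h).2⟩
  rcases hdich _ hWC with h | h
  · exact absurd (hEU _ hWC h).2 (not_le.2 hUW)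
  · exact absurd (hVE _ hWC h).2 (not_le.2 hWV)

/-- An atomless probability space carries a uniformly distributed random variable: with a chain of
events `A t` of probability `t`, take `U ω = inf {t | ω ∈ A t}` over rational `t`. -/
theorem exists_uniform_of_atomless (P : Measure Ω) [IsProbabilityMeasure P] (hP : Atomless P) :
    ∃ U : Ω → ℝ, Measurable U ∧ P.map U = volume.restrict (Ioc 0 1) := by
  obtain ⟨C, hC, hfill⟩ := exists_chain_of_atomless P hP
  choose! B hBC hB using hfill
  let A : ℚ → Set Ω := fun t => (B (ENNReal.ofReal t)).1
  have hofReal : ∀ t : ℚ, t < 1 → ENNReal.ofReal t ≤ 1 := fun t ht =>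
    ENNReal.ofReal_le_one.2 (by exact_mod_cast ht.le)
  have hA : ∀ t : ℚ, t < 1 → P (A t) = ENNReal.ofReal t := fun t ht => hB _ (hofReal t ht)
  have hAm : ∀ t, MeasurableSet (A t) := fun t => (B _).2
  have hmono : ∀ s t : ℚ, 0 < s → s < t → t < 1 → A s ⊆ A t := by
    intro s t hs hst ht
    have hlt : P (A s) < P (A t) := by
      rw [hA s (hst.trans ht), hA t ht]
      exact (ENNReal.ofReal_lt_ofReal_iff (by exact_mod_cast hs.trans hst)).2
        (by exact_mod_cast hst)
    rcases hC (hBC _ (hofReal s (hst.trans ht))) (hBC _ (hofReal t ht))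
      (fun h => hlt.ne (by simp only [A, h])) with h | h
    · exact h.1
    · exact absurd h.2 hlt.not_gt
  let S : Ω → Set ℝ := fun ω => insert 1 {x | ∃ t : ℚ, 0 < t ∧ t < 1 ∧ x = t ∧ ω ∈ A t}
  have hS0 : ∀ ω, ∀ x ∈ S ω, 0 ≤ x := by
    rintro ω x (rfl | ⟨t, ht, -, rfl, -⟩)
    · exact zero_le_one
    · exact_mod_cast ht.le
  let U : Ω → ℝ := fun ω => sInf (S ω)
  have hbdd : ∀ ω, BddBelow (S ω) := fun ω => ⟨0, hS0 ω⟩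
  have hU0 : ∀ ω, 0 ≤ U ω := fun ω => Real.sInf_nonneg (hS0 ω)
  have hU1 : ∀ ω, U ω ≤ 1 := fun ω => csInf_le (hbdd ω) (mem_insert _ _)
  have hlt : ∀ x ≤ 1, {ω | U ω < x} = ⋃ t : {t : ℚ // 0 < t ∧ t < 1 ∧ (t : ℝ) < x}, A t.1 := by
    intro x hx
    ext ω
    simp only [mem_ofPred_eq, U, mem_iUnion]
    rw [csInf_lt_iff (hbdd ω) ⟨1, mem_insert _ _⟩]
    constructor
    · rintro ⟨y, rfl | ⟨t, h0, h1, rfl, h⟩, hy⟩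
      · exact absurd hx (not_le.2 hy)
      · exact ⟨⟨t, h0, h1, hy⟩, h⟩
    · rintro ⟨⟨t, h0, h1, hy⟩, h⟩
      exact ⟨t, Or.inr ⟨t, h0, h1, rfl, h⟩, hy⟩
  have hmeas : Measurable U := by
    refine measurable_of_Iio fun x => ?_
    rcases le_or_gt x 1 with hx | hx
    · change MeasurableSet {ω | U ω < x}
      rw [hlt x hx]
      exact MeasurableSet.iUnion fun t => hAm _
    · have : U ⁻¹' Iio x = univ := eq_univ_of_forall fun ω => (hU1 ω).trans_lt hx
      rw [this]
      exact MeasurableSet.univ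
  have hPlt : ∀ x, 0 ≤ x → x ≤ 1 → P {ω | U ω < x} = ENNReal.ofReal x := by
    intro x hx0 hx
    rw [hlt x hx]
    have hdir : Directed (· ⊆ ·)
        fun t : {t : ℚ // 0 < t ∧ t < 1 ∧ (t : ℝ) < x} => A t.1 := by
      intro s t
      rcases lt_trichotomy s.1 t.1 with h | h | h
      · exact ⟨t, hmono _ _ s.2.1 h t.2.2.1, subset_rfl⟩
      · exact ⟨t, by simp only [h]; exact subset_rfl, subset_rfl⟩
      · exact ⟨s, subset_rfl, hmono _ _ t.2.1 h s.2.2.1⟩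
    rw [hdir.measure_iUnion]
    refine le_antisymm (iSup_le fun t => ?_) (le_of_forall_lt fun y hy => ?_)
    · rw [hA _ t.2.2.1]
      exact ENNReal.ofReal_le_ofReal t.2.2.2.le
    · have hy' : y.toReal < x := by
        rwa [ENNReal.lt_ofReal_iff_toReal_lt (ne_top_of_lt hy)] at hy
      obtain ⟨t, ht1, ht2⟩ := exists_rat_btwn hy'
      have ht0 : 0 < t := by exact_mod_cast (ENNReal.toReal_nonneg.trans_lt ht1)
      have ht1' : t < 1 := by exact_mod_cast ht2.trans_le hx
      refine lt_of_lt_of_le ?_ (le_iSup (fun t : {t : ℚ // 0 < t ∧ t < 1 ∧ (t : ℝ) < x} =>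
        P (A t.1)) ⟨t, ht0, ht1', ht2⟩)
      rw [hA _ ht1']
      exact (ENNReal.lt_ofReal_iff_toReal_lt (ne_top_of_lt hy)).2 ht1
  refine ⟨U, hmeas, ?_⟩
  have : IsProbabilityMeasure (P.map U) := Measure.isProbabilityMeasure_map hmeas.aemeasurable
  refine Measure.ext_of_Ici _ _ fun x => ?_
  rw [Measure.map_apply hmeas measurableSet_Ici, Measure.restrict_apply measurableSet_Ici]
  rcases le_or_gt x 0 with hx0 | hx0
  · have h1 : U ⁻¹' Ici x = univ := eq_univ_of_forall fun ω => hx0.trans (hU0 ω)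
    have h2 : Ici x ∩ Ioc (0 : ℝ) 1 = Ioc 0 1 :=
      inter_eq_right.2 fun y hy => hx0.trans hy.1.le
    rw [h1, h2]
    simp
  rcases le_or_gt x 1 with hx1 | hx1
  · have h1 : U ⁻¹' Ici x = {ω | U ω < x}ᶜ := by ext ω; simp
    have h2 : Ici x ∩ Ioc (0 : ℝ) 1 = Icc x 1 := by
      ext y
      simp only [mem_inter_iff, mem_Ici, mem_Ioc, mem_Icc]
      constructor
      · rintro ⟨h, -, h'⟩; exact ⟨h, h'⟩
      · rintro ⟨h, h'⟩; exact ⟨h, hx0.trans_le h, h'⟩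
    have hm : MeasurableSet {ω | U ω < x} := hmeas measurableSet_Iio
    rw [h1, h2, prob_compl_eq_one_sub hm, hPlt x hx0.le hx1, Real.volume_Icc,
      ENNReal.ofReal_sub _ hx0.le, ENNReal.ofReal_one]
  · have h1 : U ⁻¹' Ici x = ∅ := eq_empty_of_forall_notMem fun ω h =>
      absurd (hU1 ω) (not_le.2 (hx1.trans_le h))
    have h2 : Ici x ∩ Ioc (0 : ℝ) 1 = ∅ := eq_empty_of_forall_notMem fun y h =>
      absurd h.2.2 (not_le.2 (hx1.trans_le h.1))
    rw [h1, h2]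
    simp

end Atomless

/-! ### The sharp inequality for concave-convex functions -/

/-- The quantity on the left is the variance of the hinge function of `exists_hinge_params`, with
`w = 1 - v`. It equals the bound at `s = 2 / 3`, and the difference has a double zero there. -/
lemma hinge_variance_le_of_le_half {w s : ℝ} (hw : w ≤ 1 / 2) (hw0 : 0 ≤ w) (hs : s ≤ 1) :
    3 / 4 * s * w * ((2 - s) ^ 2 - w * (4 - 3 * s)) ≤ w * (8 - 9 * w) / 9 := by
  have h : 0 ≤ w * ((s - 2 / 3) ^ 2 * (2 - 3 * s / 4 - 9 * w / 4)) :=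
    mul_nonneg hw0 (mul_nonneg (sq_nonneg _) (by linarith))
  linarith [show w * ((s - 2 / 3) ^ 2 * (2 - 3 * s / 4 - 9 * w / 4)) =
    w * (8 - 9 * w) / 9 - 3 / 4 * s * w * ((2 - s) ^ 2 - w * (4 - 3 * s)) by ring]

lemma hinge_variance_le_of_half_le {w s : ℝ} (hw : 1 / 2 ≤ w) (hw1 : w ≤ 1) (hs : s ≤ 1)
    (hs' : 2 / 3 ≤ s) :
    3 / 4 * s * w * ((2 - s) ^ 2 - w * (4 - 3 * s)) ≤ (1 - w) * (9 * w - 1) / 9 := by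
  have h1 : 0 ≤ (1 / 9 - (s - 2 / 3) ^ 2) := by nlinarith
  have h2 : 0 ≤ (9 * w - 4) * (1 - w) := mul_nonneg (by linarith) (by linarith)
  have key : (1 - w) * (9 * w - 1) / 9 - 3 / 4 * s * w * ((2 - s) ^ 2 - w * (4 - 3 * s)) =
    (2 * w - 1) / 9 + w * ((s - 2 / 3) ^ 2 * (2 - 3 * s / 4 - 9 * w / 4)) := by ring
  by_cases h3 : 0 ≤ 2 - 3 * s / 4 - 9 * w / 4
  · have : 0 ≤ w * ((s - 2 / 3) ^ 2 * (2 - 3 * s / 4 - 9 * w / 4)) := by positivity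
    linarith
  · push Not at h3
    have h4 : 0 ≤ w * (-(2 - 3 * s / 4 - 9 * w / 4) * (1 / 9 - (s - 2 / 3) ^ 2)) :=
      mul_nonneg (by linarith) (mul_nonneg (by linarith) h1)
    have h5 : 0 ≤ w * (1 - s) := mul_nonneg (by linarith) (by linarith)
    nlinarith

/-- The parameters of the hinge function `ρ` with kink at `c ≤ v`, value `α` at `c`, and slopes `p`
and `r`, that is the `L²` projection of `1_{(v,1)}` to the hinge functions with kink at `c`. The
two long equations say that `1_{(v,1)} - ρ` is orthogonal to them, the inequalities after these
that `1_{(v,1)} - ρ` changes sign on `(v,1)`, and the last one gives the variance of `ρ`, with `s =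
(1 - v) / (1 - c)`. At `c = (3 * v - 1) / 2`, where `s = 2 / 3`, the function `ρ` is constant to
the left of the kink. At `c = 0` the left slope is irrelevant and set to `0`. -/
lemma exists_hinge_params {v c : ℝ} (hv0 : 0 < v) (hv1 : v < 1) (hc0 : 0 ≤ c) (hcv : c ≤ v)
    (hc : 3 * v - 1 ≤ 2 * c) :
    ∃ α p r s : ℝ, 2 / 3 ≤ s ∧ s ≤ 1 ∧ 0 ≤ α ∧ 0 ≤ p ∧ 0 < r ∧
      (c = 0 ∨ 2 * c = 3 * v - 1 → p = 0) ∧ (2 * p * c / 3 = α ∨ c = 0) ∧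
      1 - v = α * (1 - c) + r * (1 - c) ^ 2 / 2 + p * c ^ 2 / 6 ∧
      (1 - c) * (1 - v) - (1 - v) ^ 2 / 2 = α * (1 - c) ^ 2 / 2 + r * (1 - c) ^ 3 / 3 ∧
      1 - α < r * (1 - c) ∧ r * (v - c) < 1 - α ∧
      -(1 - v) * (1 - v - α) + r * ((1 - c) * (1 - v) - (1 - v) ^ 2 / 2) =
        3 / 4 * s * (1 - v) * ((2 - s) ^ 2 - (1 - v) * (4 - 3 * s)) := by
  obtain ⟨e, he⟩ : ∃ e, e = 1 - c := ⟨_, rfl⟩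
  obtain ⟨s, hs⟩ : ∃ s, s = (1 - v) / e := ⟨_, rfl⟩
  have he0 : 0 < e := by linarith
  have hw : 1 - v = s * e := by rw [hs]; field_simp
  have hs1 : s ≤ 1 := by rw [hs, div_le_one he0]; linarith
  have hs2 : 2 / 3 ≤ s := by rw [hs, le_div_iff₀ he0]; linarith
  have hce : c = 1 - e := by linarith
  have hve : v = 1 - s * e := by linarith
  have he1 : e ≤ 1 := by linarith
  have hse : s * e < 1 := by linarith
  have hA : 0 < 2 + 2 * e - (1 + 3 * e) * s := by
    rcases hs1.lt_or_eq with h | h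
    · nlinarith
    · subst h; linarith
  refine ⟨s * e * (3 * s - 2), if c = 0 then 0 else 3 * (s * e * (3 * s - 2)) / (2 * c),
    3 * s / (2 * e) * (2 + 2 * e - (1 + 3 * e) * s), s, hs2, hs1, ?_, ?_, ?_, ?_, ?_, ?_, ?_, ?_, ?_,
    ?_⟩
  · exact mul_nonneg (by positivity) (by linarith)
  · split_ifs
    · rfl
    · exact div_nonneg (mul_nonneg (by norm_num) (mul_nonneg (by positivity) (by linarith)))
        (by positivity)
  · positivity
  · rintro (h | h)
    · simp [h]
    · have : 3 * s - 2 = 0 := by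
        have : e * (3 * s - 2) = 0 := by linarith
        rcases mul_eq_zero.1 this with h | h
        · exact absurd h he0.ne'
        · exact h
      simp [this]
  · by_cases h : c = 0
    · exact Or.inr h
    · left
      rw [if_neg h]; field_simp
  · have : (if c = 0 then 0 else 3 * (s * e * (3 * s - 2)) / (2 * c)) * c ^ 2 / 6 =
        s * e * (3 * s - 2) * c / 4 := by
      by_cases h : c = 0
      · simp [h]
      · rw [if_neg h]; field_simp; ring
    rw [this, hw, ← he]
    have : 3 * s / (2 * e) * (2 + 2 * e - (1 + 3 * e) * s) * e ^ 2 / 2 =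
      3 * s * e * (2 + 2 * e - (1 + 3 * e) * s) / 4 := by field_simp; ring
    rw [this, hce]; ring
  · rw [hw, ← he]
    field_simp
    ring
  · rw [← he]
    have : 3 * s / (2 * e) * (2 + 2 * e - (1 + 3 * e) * s) * e =
      3 * s / 2 * (2 + 2 * e - (1 + 3 * e) * s) := by field_simp
    rw [this]
    rcases hs1.lt_or_eq with h | h
    · have h1 : 0 < (3 * s - 1) * (1 - s) := mul_pos (by linarith) (by linarith)
      have h2 : 0 ≤ (1 - e) * (s * (3 / 2 * s - 1)) :=
        mul_nonneg (by linarith) (mul_nonneg (by linarith) (by linarith))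
      nlinarith
    · subst h; linarith
  · have h0 : v - c = e * (1 - s) := by rw [hve, hce]; ring
    have : 3 * s / (2 * e) * (2 + 2 * e - (1 + 3 * e) * s) * (v - c) =
      3 * s / 2 * (2 + 2 * e - (1 + 3 * e) * s) * (1 - s) := by rw [h0]; field_simp
    rw [this]
    rcases hs1.lt_or_eq with h | h
    · have h1 : 0 < (1 - s) * (6 * s ^ 2 - 3 * s + 1) :=
        mul_pos (by linarith) (by nlinarith)
      have h2 : 0 < 1 - 3 * s + 9 / 2 * s ^ 2 - 3 / 2 * s ^ 3 := by
        have : 0 ≤ s ^ 2 * (1 - s) := by nlinarith [sq_nonneg s]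
        nlinarith
      have h3 : 1 - s * e * (3 * s - 2) - 3 * s / 2 * (2 + 2 * e - (1 + 3 * e) * s) * (1 - s) =
        (1 - e) * (1 - 3 * s + 9 / 2 * s ^ 2 - 3 / 2 * s ^ 3) +
          e * ((1 - s) * (6 * s ^ 2 - 3 * s + 1)) := by ring
      have h4 := mul_pos he0 h1
      have h5 := mul_nonneg (by linarith : 0 ≤ 1 - e) h2.le
      linarith
    · subst h; linarith
  · rw [hw, ← he]
    field_simp
    ring

/-- The continuous piecewise linear function with a single kink, at `c`: it takes the value `a` at
`c` and has slope `l` on the left and `r` on the right of `c`. -/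
def hinge (c a l r u : ℝ) : ℝ := a + l * min (u - c) 0 + r * max (u - c) 0

lemma hinge_of_le {c u : ℝ} (h : u ≤ c) (a l r : ℝ) : hinge c a l r u = a + l * (u - c) := by
  simp [hinge, min_eq_left (sub_nonpos.2 h), max_eq_right (sub_nonpos.2 h)]

lemma hinge_of_ge {c u : ℝ} (h : c ≤ u) (a l r : ℝ) : hinge c a l r u = a + r * (u - c) := by
  simp [hinge, min_eq_right (sub_nonneg.2 h), max_eq_left (sub_nonneg.2 h)]

lemma continuous_hinge (c a l r : ℝ) : Continuous (hinge c a l r) := by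
  unfold hinge; fun_prop

lemma integral_linear_mul_linear (x y c A B a m : ℝ) :
    ∫ u in x..y, (A + B * (u - c)) * (a + m * (u - c)) =
      (A * a * (y - c) + (A * m + B * a) * (y - c) ^ 2 / 2 + B * m * (y - c) ^ 3 / 3) -
      (A * a * (x - c) + (A * m + B * a) * (x - c) ^ 2 / 2 + B * m * (x - c) ^ 3 / 3) := by
  refine intervalIntegral.integral_eq_sub_of_hasDerivAt
    (f := fun u => A * a * (u - c) + (A * m + B * a) * (u - c) ^ 2 / 2 + B * m * (u - c) ^ 3 / 3)
    (fun u _ => ?_) (Continuous.intervalIntegrable (by fun_prop) _ _)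
  have h : HasDerivAt (fun u : ℝ => u - c) 1 u := (hasDerivAt_id u).sub_const c
  refine (((h.const_mul (A * a)).add (((h.pow 2).const_mul (A * m + B * a)).div_const 2)).add
    (((h.pow 3).const_mul (B * m)).div_const 3)).congr_deriv ?_
  norm_num
  ring

lemma integral_hinge_mul_hinge {c : ℝ} (h0 : 0 ≤ c) (h1 : c ≤ 1) (A L R a l r : ℝ) :
    ∫ u in (0 : ℝ)..1, hinge c A L R u * hinge c a l r u =
      (A * a * c - (A * l + L * a) * c ^ 2 / 2 + L * l * c ^ 3 / 3) +
      (A * a * (1 - c) + (A * r + R * a) * (1 - c) ^ 2 / 2 + R * r * (1 - c) ^ 3 / 3) := by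
  have hc : Continuous fun u => hinge c A L R u * hinge c a l r u :=
    (continuous_hinge _ _ _ _).mul (continuous_hinge _ _ _ _)
  rw [← intervalIntegral.integral_add_adjacent_intervals (b := c) (hc.intervalIntegrable _ _)
    (hc.intervalIntegrable _ _)]
  congr 1
  · rw [intervalIntegral.integral_congr (g := fun u => (A + L * (u - c)) * (a + l * (u - c))),
      integral_linear_mul_linear]
    · ring
    · intro u hu
      rw [uIcc_of_le h0] at hu
      simp only [hinge_of_le hu.2]
  · rw [intervalIntegral.integral_congr (g := fun u => (A + R * (u - c)) * (a + r * (u - c))),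
      integral_linear_mul_linear]
    · ring
    · intro u hu
      rw [uIcc_of_le h1] at hu
      simp only [hinge_of_ge hu.1]

lemma integral_hinge_right {c v : ℝ} (hcv : c ≤ v) (hv : v ≤ 1) (a l r : ℝ) :
    ∫ u in v..1, hinge c a l r u =
      a * (1 - v) + r * ((1 - c) * (1 - v) - (1 - v) ^ 2 / 2) := by
  rw [intervalIntegral.integral_congr (g := fun u => (1 + 0 * (u - c)) * (a + r * (u - c))),
      integral_linear_mul_linear]
  · ring
  · intro u hu
    rw [uIcc_of_le hv] at hu
    simp only [hinge_of_ge (hcv.trans hu.1)]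
    ring

/-- The functional `∫ q (1_{(v,1)} - (1 - v))`. For the quantile function `q` of a distribution
function `F` it is the integral of `min (F x) v - F x * v` over `x`. -/
def tailGap (v : ℝ) (q : ℝ → ℝ) : ℝ := (∫ u in v..1, q u) - (1 - v) * ∫ u in (0 : ℝ)..1, q u

/-- `1_{(v,1)} - ρ` is orthogonal to the hinge functions with kink at `c`. -/
lemma integral_hinge_right_eq_integral_mul {v c α p r : ℝ} (hc0 : 0 ≤ c) (hcv : c ≤ v) (hv1 : v ≤ 1)
    (hpc : 2 * p * c / 3 = α ∨ c = 0)
    (h1 : 1 - v = α * (1 - c) + r * (1 - c) ^ 2 / 2 + p * c ^ 2 / 6)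
    (h2 : (1 - c) * (1 - v) - (1 - v) ^ 2 / 2 = α * (1 - c) ^ 2 / 2 + r * (1 - c) ^ 3 / 3)
    (a l m : ℝ) :
    (∫ u in v..1, hinge c a l m u) =
      ∫ u in (0 : ℝ)..1, hinge c α p r u * hinge c a l m u := by
  rw [integral_hinge_right hcv hv1, integral_hinge_mul_hinge hc0 (hcv.trans hv1), h2, h1]
  rcases hpc with rfl | rfl <;> ring

/-- A function `q` that is concave to the left and convex to the right of `c` crosses a suitable
hinge function with kink at `c` where `1_{(v,1)} - ρ` changes sign, for `ρ = hinge c α p r`: the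
product of the two differences is nowhere positive. If `p = 0`, then `ρ` vanishes to the left of
`c` (unless `c = 0`), and no concavity is needed. -/
lemma exists_hinge_comparison {v c α p r : ℝ} (hv0 : 0 < v)
    (hv1 : v < 1) (hcv : c ≤ v)
    (hα : 0 ≤ α) (hp : 0 ≤ p) (hr : 0 < r) (hpc : 2 * p * c / 3 = α ∨ c = 0)
    (hr1 : 1 - α < r * (1 - c)) (hr2 : r * (v - c) < 1 - α) {q : ℝ → ℝ}
    (hconv : ConvexOn ℝ (Ioo 0 1 ∩ Ici c) q)
    (hconc : p = 0 ∨ 0 < c ∧ ConcaveOn ℝ (Ioo 0 1 ∩ Iic c) q) :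
    ∃ a l m : ℝ, ∀ u ∈ Ioo (0 : ℝ) 1,
      (u ≤ v → 0 ≤ hinge c α p r u * (q u - hinge c a l m u)) ∧
      (v < u → (1 - hinge c α p r u) * (q u - hinge c a l m u) ≤ 0) := by
  -- the zero of `1 - ρ` in `(v, 1)`
  obtain ⟨z, hz⟩ : ∃ z, z = c + (1 - α) / r := ⟨_, rfl⟩
  have hzr : r * (z - c) = 1 - α := by rw [hz]; field_simp; ring
  have hvz : v < z := by
    have : r * (v - c) < r * (z - c) := by linarith
    linarith [lt_of_mul_lt_mul_left this hr.le]
  have hz1 : z < 1 := by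
    have : r * (z - c) < r * (1 - c) := by linarith
    linarith [lt_of_mul_lt_mul_left this hr.le]
  have hvm : v ∈ Ioo (0 : ℝ) 1 ∩ Ici c := ⟨⟨hv0, hv1⟩, hcv⟩
  have hzm : z ∈ Ioo (0 : ℝ) 1 ∩ Ici c := ⟨⟨hv0.trans hvz, hz1⟩, hcv.trans hvz.le⟩
  obtain ⟨m, hm⟩ : ∃ m, m = (q z - q v) / (z - v) := ⟨_, rfl⟩
  have hmz : m * (z - v) = q z - q v := by
    rw [hm]; field_simp [(sub_pos.2 hvz).ne']
  -- the line through the points of the graph of `q` over `v` and `z`, at its value over `c`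
  obtain ⟨a, ha⟩ : ∃ a, a = q v - m * (v - c) := ⟨_, rfl⟩
  have hR1 : ∀ u ∈ Ioo (0 : ℝ) 1, c ≤ u → u ≤ v → a + m * (u - c) ≤ q u := by
    intro u hu hcu huv
    rcases huv.eq_or_lt with rfl | huv
    · linarith
    have := hconv.slope_mono_adjacent ⟨hu, hcu⟩ hzm huv hvz
    rw [← hm, div_le_iff₀ (sub_pos.2 huv)] at this
    linarith
  have hR2 : ∀ u ∈ Ioo (0 : ℝ) 1, v < u → u ≤ z → q u ≤ a + m * (u - c) := by
    intro u hu hvu huz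
    have := hconv.secant_mono hvm ⟨hu, hcv.trans hvu.le⟩ hzm hvu.ne' hvz.ne' huz
    rw [← hm, div_le_iff₀ (sub_pos.2 hvu)] at this
    linarith
  have hR3 : ∀ u ∈ Ioo (0 : ℝ) 1, z < u → a + m * (u - c) ≤ q u := by
    intro u hu hzu
    have := hconv.secant_mono hvm hzm ⟨hu, hcv.trans (hvz.trans hzu).le⟩ hvz.ne'
      (hvz.trans hzu).ne' hzu.le
    rw [← hm, le_div_iff₀ (sub_pos.2 (hvz.trans hzu))] at this
    linarith
  have hright : ∀ l, ∀ u ∈ Ioo (0 : ℝ) 1, c ≤ u →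
      (u ≤ v → 0 ≤ hinge c α p r u * (q u - hinge c a l m u)) ∧
      (v < u → (1 - hinge c α p r u) * (q u - hinge c a l m u) ≤ 0) := by
    intro l u hu hcu
    rw [hinge_of_ge hcu, hinge_of_ge hcu]
    refine ⟨fun huv => ?_, fun hvu => ?_⟩
    · have h1 := hR1 u hu hcu huv
      have h2 : 0 ≤ r * (u - c) := mul_nonneg hr.le (by linarith)
      exact mul_nonneg (by linarith) (by linarith)
    · have h3 : 1 - (α + r * (u - c)) = r * (z - u) := by linarith
      rw [h3]
      rcases le_or_gt u z with huz | hzu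
      · exact mul_nonpos_of_nonneg_of_nonpos (mul_nonneg hr.le (by linarith))
          (by linarith [hR2 u hu hvu huz])
      · exact mul_nonpos_of_nonpos_of_nonneg
          (mul_nonpos_of_nonneg_of_nonpos hr.le (by linarith)) (by linarith [hR3 u hu hzu])
  rcases hconc with rfl | ⟨hc0', hconc⟩
  · have h0 : c = 0 ∨ α = 0 := by
      rcases hpc with h | h
      · right; linarith
      · exact Or.inl h
    refine ⟨a, 0, m, fun u hu => ?_⟩
    rcases le_or_gt c u with hcu | huc
    · exact hright 0 u hu hcu
    · rcases h0 with h | h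
      · exact absurd hu.1 (by linarith)
      · refine ⟨fun _ => ?_, fun h' => absurd h' (by linarith)⟩
        rw [hinge_of_le huc.le, h]
        simp
  · have hα' : 2 * p * c / 3 = α := hpc.resolve_right hc0'.ne'
    have hc1 : c < 1 := hcv.trans_lt hv1
    have hac : a ≤ q c := by
      have := hR1 c ⟨hc0', hc1⟩ le_rfl hcv
      linarith
    have hcm : c ∈ Ioo (0 : ℝ) 1 ∩ Iic c := ⟨⟨hc0', hc1⟩, self_mem_Iic⟩
    have htm : c / 3 ∈ Ioo (0 : ℝ) 1 ∩ Iic c :=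
      ⟨⟨by linarith, by linarith⟩, by simp only [mem_Iic]; linarith⟩
    -- the line through `(c / 3, q (c / 3))` and `(c, a)`; the zero of `ρ` is at `c / 3`
    obtain ⟨l, hl⟩ : ∃ l, l = (a - q (c / 3)) / (c - c / 3) := ⟨_, rfl⟩
    have hlc : l * (c - c / 3) = a - q (c / 3) := by
      rw [hl]; field_simp
    refine ⟨a, l, m, fun u hu => ?_⟩
    rcases le_or_gt c u with hcu | huc
    · exact hright l u hu hcu
    refine ⟨fun _ => ?_, fun h' => absurd h' (by linarith)⟩
    have hum : u ∈ Ioo (0 : ℝ) 1 ∩ Iic c := ⟨hu, huc.le⟩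
    rw [hinge_of_le huc.le, hinge_of_le huc.le, ← hα']
    have h3 : 2 * p * c / 3 + p * (u - c) = p * (u - c / 3) := by ring
    rw [h3]
    rcases lt_trichotomy u (c / 3) with h | h | h
    · have := hconc.slope_anti_adjacent hum hcm h (by linarith : c / 3 < c)
      rw [div_le_div_iff₀ (by linarith) (by linarith)] at this
      have h4 : (a - q (c / 3)) * (c / 3 - u) ≤ (q c - q (c / 3)) * (c / 3 - u) :=
        mul_le_mul_of_nonneg_right (by linarith) (by linarith)
      have h5 : q u ≤ a + l * (u - c) := by
        have h6 : l * (c - c / 3) * (c / 3 - u) ≤ (q (c / 3) - q u) * (c - c / 3) := by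
          rw [hlc]; linarith
        have h7 : (l * (c / 3 - u)) * (c - c / 3) ≤ (q (c / 3) - q u) * (c - c / 3) := by linarith
        have := le_of_mul_le_mul_right h7 (by linarith)
        linarith
      exact mul_nonneg_of_nonpos_of_nonpos
        (mul_nonpos_of_nonneg_of_nonpos hp (by linarith)) (by linarith)
    · subst h; simp
    · have := hconc.slope_anti_adjacent htm hcm h huc
      rw [div_le_div_iff₀ (by linarith) (by linarith)] at this
      have h5 : a + l * (u - c) ≤ q u := by
        have h8 : (a - q c) * (u - c / 3) ≤ 0 :=
          mul_nonpos_of_nonpos_of_nonneg (by linarith) (by linarith)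
        have h7 : (q (c / 3) + l * (u - c / 3)) * (c - c / 3) ≤ q u * (c - c / 3) := by
          have : l * (u - c / 3) * (c - c / 3) = (a - q (c / 3)) * (u - c / 3) := by
            rw [← hlc]; ring
          linarith
        have := le_of_mul_le_mul_right h7 (by linarith)
        linarith
      exact mul_nonneg (mul_nonneg hp (by linarith)) (by linarith)

lemma integral_right_le_integral_hinge_mul {v c α p r : ℝ} (hc0 : 0 ≤ c) (hv0 : 0 < v) (hv1 : v < 1)
    (hcv : c ≤ v) (hpc : 2 * p * c / 3 = α ∨ c = 0)
    (h1 : 1 - v = α * (1 - c) + r * (1 - c) ^ 2 / 2 + p * c ^ 2 / 6)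
    (h2 : (1 - c) * (1 - v) - (1 - v) ^ 2 / 2 = α * (1 - c) ^ 2 / 2 + r * (1 - c) ^ 3 / 3)
    {q : ℝ → ℝ} (hq : IntervalIntegrable q volume 0 1) {a l m : ℝ}
    (h : ∀ u ∈ Ioo (0 : ℝ) 1,
      (u ≤ v → 0 ≤ hinge c α p r u * (q u - hinge c a l m u)) ∧
      (v < u → (1 - hinge c α p r u) * (q u - hinge c a l m u) ≤ 0)) :
    (∫ u in v..1, q u) ≤ ∫ u in (0 : ℝ)..1, hinge c α p r u * q u := by
  have hv01 : v ∈ uIcc (0 : ℝ) 1 := by rw [uIcc_of_le zero_le_one]; exact ⟨hv0.le, hv1.le⟩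
  have hcont := continuous_hinge c α p r
  have hcont' := continuous_hinge c a l m
  have hd : IntervalIntegrable (fun u => q u - hinge c a l m u) volume 0 1 :=
    hq.sub (hcont'.intervalIntegrable _ _)
  have hd0 : IntervalIntegrable (fun u => q u - hinge c a l m u) volume 0 v :=
    hd.mono_set (uIcc_subset_uIcc left_mem_uIcc hv01)
  have hd1 : IntervalIntegrable (fun u => q u - hinge c a l m u) volume v 1 :=
    hd.mono_set (uIcc_subset_uIcc hv01 right_mem_uIcc)
  have hp0 := hd0.continuousOn_mul hcont.continuousOn
  have hp1 := hd1.continuousOn_mul hcont.continuousOn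
  have hL : 0 ≤ ∫ u in (0 : ℝ)..v, hinge c α p r u * (q u - hinge c a l m u) :=
    intervalIntegral.integral_nonneg_of_ae_restrict hv0.le <| by
      filter_upwards [ae_restrict_of_ae (Measure.ae_ne volume (0:ℝ)),
        ae_restrict_mem measurableSet_Icc] with u hu0 hu
      exact (h u ⟨lt_of_le_of_ne hu.1 (Ne.symm hu0), hu.2.trans_lt hv1⟩).1 hu.2
  have hR : (∫ u in v..1, (q u - hinge c a l m u)) ≤
      ∫ u in v..1, hinge c α p r u * (q u - hinge c a l m u) := by
    refine intervalIntegral.integral_mono_ae_restrict hv1.le hd1 hp1 ?_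
    filter_upwards [ae_restrict_of_ae (Measure.ae_ne volume (1:ℝ)),
      ae_restrict_of_ae (Measure.ae_ne volume v), ae_restrict_mem measurableSet_Icc] with u h1 hv hu
    have := (h u ⟨hv0.trans_le hu.1, lt_of_le_of_ne hu.2 h1⟩).2 (lt_of_le_of_ne hu.1 (Ne.symm hv))
    linarith
  have hsplit := intervalIntegral.integral_add_adjacent_intervals hp0 hp1
  have e1 : ∫ u in (0 : ℝ)..1, hinge c α p r u * (q u - hinge c a l m u) =
      (∫ u in (0 : ℝ)..1, hinge c α p r u * q u) -
        ∫ u in (0 : ℝ)..1, hinge c α p r u * hinge c a l m u := by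
    have := intervalIntegral.integral_sub (hq.continuousOn_mul hcont.continuousOn)
      ((hcont.mul hcont').intervalIntegrable _ _)
    simpa only [mul_sub, Pi.mul_apply] using this
  have e2 : ∫ u in v..1, (q u - hinge c a l m u) =
      (∫ u in v..1, q u) - ∫ u in v..1, hinge c a l m u :=
    intervalIntegral.integral_sub (hq.mono_set (uIcc_subset_uIcc hv01 right_mem_uIcc))
      (hcont'.intervalIntegrable _ _)
  have e3 := integral_hinge_right_eq_integral_mul hc0 hcv hv1.le hpc h1 h2 a l m
  linarith

/-- The sharp constant `κ v` in the bound `tailGap v q ≤ κ v / 3 * σ` for quantile functions `q` of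
unimodal laws with standard deviation `σ`; it is the integrand of `Θ`. -/
def unimodalBound (v : ℝ) : ℝ :=
  if v ≤ 1 / 2 then √(v * (8 - 9 * v)) else √((9 * v - 1) * (1 - v))

lemma unimodalBound_one_sub (v : ℝ) : unimodalBound (1 - v) = unimodalBound v := by
  unfold unimodalBound
  rcases lt_trichotomy v (1 / 2) with h | h | h
  · rw [if_neg (by linarith), if_pos h.le]
    congr 1; ring
  · subst h; norm_num
  · rw [if_pos (by linarith), if_neg (by linarith)]
    congr 1; ring

lemma integral_sub_sq {q : ℝ → ℝ} (hq : IntervalIntegrable q volume 0 1)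
    (hq2 : IntervalIntegrable (fun u => q u ^ 2) volume 0 1) {g : ℝ → ℝ} (hg : Continuous g) :
    ∫ u in (0 : ℝ)..1, (q u - g u) ^ 2 =
      (∫ u in (0 : ℝ)..1, q u ^ 2) - 2 * (∫ u in (0 : ℝ)..1, g u * q u) +
        ∫ u in (0 : ℝ)..1, g u ^ 2 := by
  have h1 := hq.continuousOn_mul hg.continuousOn
  have h2 : IntervalIntegrable (fun u => g u ^ 2) volume 0 1 := (hg.pow 2).intervalIntegrable _ _
  rw [← intervalIntegral.integral_const_mul, ← intervalIntegral.integral_sub hq2 (h1.const_mul 2),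
    ← intervalIntegral.integral_add (hq2.sub (h1.const_mul 2)) h2]
  refine intervalIntegral.integral_congr fun u _ => ?_
  ring

/-- The Cauchy-Schwarz inequality for the covariance of `ρ` and `q`, with a bound `N` for the
variance of `ρ`. -/
lemma covariance_le {q ρ : ℝ → ℝ} (hq : IntervalIntegrable q volume 0 1)
    (hq2 : IntervalIntegrable (fun u => q u ^ 2) volume 0 1) (hρ : Continuous ρ) {N : ℝ}
    (hN : (∫ u in (0 : ℝ)..1, ρ u ^ 2) - (∫ u in (0 : ℝ)..1, ρ u) ^ 2 ≤ N) :
    (∫ u in (0 : ℝ)..1, ρ u * q u) - (∫ u in (0 : ℝ)..1, ρ u) * (∫ u in (0 : ℝ)..1, q u) ≤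
      √(N * ((∫ u in (0 : ℝ)..1, q u ^ 2) - (∫ u in (0 : ℝ)..1, q u) ^ 2)) := by
  obtain ⟨m, hm⟩ : ∃ m, m = ∫ u in (0 : ℝ)..1, q u := ⟨_, rfl⟩
  obtain ⟨M, hM⟩ : ∃ M, M = ∫ u in (0 : ℝ)..1, q u ^ 2 := ⟨_, rfl⟩
  obtain ⟨w, hw⟩ : ∃ w, w = ∫ u in (0 : ℝ)..1, ρ u := ⟨_, rfl⟩
  obtain ⟨W, hW⟩ : ∃ W, W = ∫ u in (0 : ℝ)..1, ρ u ^ 2 := ⟨_, rfl⟩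
  obtain ⟨C, hC⟩ : ∃ C, C = ∫ u in (0 : ℝ)..1, ρ u * q u := ⟨_, rfl⟩
  rw [← hw, ← hW] at hN
  rw [← hw, ← hC, ← hm, ← hM]
  have key : ∀ t : ℝ, 0 ≤ (W - w ^ 2) * (t * t) + (-(2 * (C - w * m))) * t + (M - m ^ 2) := by
    intro t
    have h0 : 0 ≤ ∫ u in (0 : ℝ)..1, (q u - ((m - t * w) + t * ρ u)) ^ 2 :=
      intervalIntegral.integral_nonneg zero_le_one fun u _ => sq_nonneg _
    rw [integral_sub_sq hq hq2 (by fun_prop)] at h0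
    have h1 : ∫ u in (0 : ℝ)..1, ((m - t * w) + t * ρ u) * q u = (m - t * w) * m + t * C := by
      rw [hC, hm, ← intervalIntegral.integral_const_mul, ← intervalIntegral.integral_const_mul,
        ← intervalIntegral.integral_add (hq.const_mul _)
          ((hq.continuousOn_mul hρ.continuousOn).const_mul _)]
      refine intervalIntegral.integral_congr fun u _ => ?_
      ring
    have h2 : ∫ u in (0 : ℝ)..1, ((m - t * w) + t * ρ u) ^ 2 =
        (m - t * w) ^ 2 + 2 * (m - t * w) * t * w + t ^ 2 * W := by
      have i1 : IntervalIntegrable (fun u => 2 * (m - t * w) * t * ρ u) volume 0 1 :=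
        Continuous.intervalIntegrable (by fun_prop) _ _
      have i2 : IntervalIntegrable (fun u => t ^ 2 * ρ u ^ 2) volume 0 1 :=
        Continuous.intervalIntegrable (by fun_prop) _ _
      have e : ∫ u in (0 : ℝ)..1, ((m - t * w) + t * ρ u) ^ 2 =
          ∫ u in (0 : ℝ)..1, ((m - t * w) ^ 2 + 2 * (m - t * w) * t * ρ u + t ^ 2 * ρ u ^ 2) := by
        refine intervalIntegral.integral_congr fun u _ => ?_
        ring
      rw [e, intervalIntegral.integral_add (intervalIntegrable_const.add i1) i2,
        intervalIntegral.integral_add intervalIntegrable_const i1,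
        intervalIntegral.integral_const_mul, intervalIntegral.integral_const_mul,
        intervalIntegral.integral_const, ← hw, ← hW]
      simp
    rw [h1, h2, ← hM] at h0
    linarith
  have hd := discrim_le_zero key
  have hV : 0 ≤ M - m ^ 2 := by simpa using key 0
  unfold discrim at hd
  refine (le_abs_self _).trans (Real.abs_le_sqrt ?_)
  have := mul_le_mul_of_nonneg_right hN hV
  linarith

/-- The case of `tailGap_le` in which the inflection point does not exceed `v`. It may then be
moved to the right, up to the point `(3 * v - 1) / 2` where concavity is no longer needed. -/
lemma tailGap_le_of_inflection_le {v c : ℝ} {q : ℝ → ℝ} (hv0 : 0 < v) (hv1 : v < 1)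
    (hc0 : 0 ≤ c) (hcv : c ≤ v) (hconv : ConvexOn ℝ (Ioo 0 1 ∩ Ici c) q)
    (hconc : ConcaveOn ℝ (Ioo 0 1 ∩ Iic c) q) (hq : IntervalIntegrable q volume 0 1)
    (hq2 : IntervalIntegrable (fun u => q u ^ 2) volume 0 1) :
    tailGap v q ≤ unimodalBound v / 3 *
      √((∫ u in (0 : ℝ)..1, q u ^ 2) - (∫ u in (0 : ℝ)..1, q u) ^ 2) := by
  obtain ⟨d, hd⟩ : ∃ d, d = max c ((3 * v - 1) / 2) := ⟨_, rfl⟩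
  have hcd : c ≤ d := hd ▸ le_max_left _ _
  have hd2 : (3 * v - 1) / 2 ≤ d := hd ▸ le_max_right _ _
  have hdv : d ≤ v := hd ▸ max_le hcv (by linarith)
  have hd0 : 0 ≤ d := hc0.trans hcd
  obtain ⟨α, p, r, s, hs2, hs1, hα, hp, hr, hp0, hpc, h1, h2, hr1, hr2, hN⟩ :=
    exists_hinge_params hv0 hv1 hd0 hdv (by linarith)
  have hconv' : ConvexOn ℝ (Ioo 0 1 ∩ Ici d) q :=
    hconv.subset (inter_subset_inter_right _ (Ici_subset_Ici.2 hcd))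
      ((convex_Ioo 0 1).inter (convex_Ici d))
  have hconc' : p = 0 ∨ 0 < d ∧ ConcaveOn ℝ (Ioo 0 1 ∩ Iic d) q := by
    rcases max_choice c ((3 * v - 1) / 2) with h | h
    · rw [h] at hd
      rcases hd0.eq_or_lt with h0 | h0
      · exact Or.inl (hp0 (Or.inl h0.symm))
      · exact Or.inr ⟨h0, by rw [hd]; exact hconc⟩
    · exact Or.inl (hp0 (Or.inr (by rw [hd, h]; ring)))
  obtain ⟨a, l, m, hcmp⟩ := exists_hinge_comparison hv0 hv1 hdv hα hp hr hpc hr1 hr2 hconv' hconc'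
  have hle := integral_right_le_integral_hinge_mul hd0 hv0 hv1 hdv hpc h1 h2 hq hcmp
  have hρ1 : ∫ u in (0 : ℝ)..1, hinge d α p r u = 1 - v := by
    have := integral_hinge_right_eq_integral_mul hd0 hdv hv1.le hpc h1 h2 1 0 0
    have h3 : ∀ u, hinge d 1 0 0 u = 1 := fun u => by simp [hinge]
    rw [integral_hinge_right hdv hv1.le] at this
    simp only [h3, mul_one] at this
    linarith
  have hρ2 : ∫ u in (0 : ℝ)..1, hinge d α p r u ^ 2 =
      α * (1 - v) + r * ((1 - d) * (1 - v) - (1 - v) ^ 2 / 2) := by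
    have := integral_hinge_right_eq_integral_mul hd0 hdv hv1.le hpc h1 h2 α p r
    rw [integral_hinge_right hdv hv1.le] at this
    rw [this]
    simp only [sq]
  have hNle : 3 / 4 * s * (1 - v) * ((2 - s) ^ 2 - (1 - v) * (4 - 3 * s)) ≤
      (unimodalBound v / 3) ^ 2 := by
    unfold unimodalBound
    rw [div_pow]
    split_ifs with h
    · rw [Real.sq_sqrt (mul_nonneg hv0.le (by linarith))]
      have := hinge_variance_le_of_half_le (w := 1 - v) (s := s) (by linarith) (by linarith) hs1 hs2
      linarith
    · rw [Real.sq_sqrt (mul_nonneg (by linarith) (by linarith))]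
      have := hinge_variance_le_of_le_half (w := 1 - v) (s := s) (by linarith) (by linarith) hs1
      linarith
  have hcs := covariance_le hq hq2 (continuous_hinge d α p r) (N := (unimodalBound v / 3) ^ 2) (by
    rw [hρ1, hρ2]
    linarith)
  have hk : 0 ≤ unimodalBound v / 3 := by
    unfold unimodalBound; split_ifs <;> positivity
  rw [Real.sqrt_mul (sq_nonneg _), Real.sqrt_sq hk, hρ1] at hcs
  unfold tailGap
  linarith

lemma tailGap_one_sub {v : ℝ} (hv0 : 0 < v) (hv1 : v < 1) {q : ℝ → ℝ}
    (hq : IntervalIntegrable q volume 0 1) :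
    tailGap (1 - v) (fun u => -q (1 - u)) = tailGap v q := by
  unfold tailGap
  have hv01 : v ∈ uIcc (0 : ℝ) 1 := by rw [uIcc_of_le zero_le_one]; exact ⟨hv0.le, hv1.le⟩
  rw [intervalIntegral.integral_neg, intervalIntegral.integral_neg,
    intervalIntegral.integral_comp_sub_left (fun u => q u),
    intervalIntegral.integral_comp_sub_left (fun u => q u)]
  have := intervalIntegral.integral_add_adjacent_intervals
    (hq.mono_set (uIcc_subset_uIcc left_mem_uIcc hv01))
    (hq.mono_set (uIcc_subset_uIcc hv01 right_mem_uIcc))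
  simp only [sub_self, sub_sub_cancel, sub_zero]
  linarith

/-- The sharp bound for a function that is concave to the left and convex to the right of some
`c ∈ [0,1]`. Inflection points above `v` are reduced to those below by the reflection
`u ↦ -q (1 - u)`. -/
theorem tailGap_le {v c : ℝ} {q : ℝ → ℝ} (hv0 : 0 < v) (hv1 : v < 1)
    (hc0 : 0 ≤ c) (hc1 : c ≤ 1) (hconv : ConvexOn ℝ (Ioo 0 1 ∩ Ici c) q)
    (hconc : ConcaveOn ℝ (Ioo 0 1 ∩ Iic c) q) (hq : IntervalIntegrable q volume 0 1)
    (hq2 : IntervalIntegrable (fun u => q u ^ 2) volume 0 1) :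
    tailGap v q ≤ unimodalBound v / 3 *
      √((∫ u in (0 : ℝ)..1, q u ^ 2) - (∫ u in (0 : ℝ)..1, q u) ^ 2) := by
  rcases le_total c v with h | h
  · exact tailGap_le_of_inflection_le hv0 hv1 hc0 h hconv hconc hq hq2
  have hI : IntervalIntegrable (fun u => q (1 - u)) volume 0 1 := by
    simpa using (hq.comp_sub_left 1).symm
  have hI2 : IntervalIntegrable (fun u => q (1 - u) ^ 2) volume 0 1 := by
    simpa using (hq2.comp_sub_left 1).symm
  let f : ℝ →ᵃ[ℝ] ℝ := AffineMap.const ℝ ℝ 1 - AffineMap.id ℝ ℝ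
  have hf : ∀ u, f u = 1 - u := fun u => by simp [f]
  have hv := tailGap_le_of_inflection_le (v := 1 - v) (c := 1 - c) (q := fun u => -q (1 - u))
    (by linarith) (by linarith) (by linarith) (by linarith) ?_ ?_ hI.neg
    (by simpa only [neg_sq] using hI2)
  · rw [tailGap_one_sub hv0 hv1 hq, unimodalBound_one_sub] at hv
    refine hv.trans_eq ?_
    simp only [neg_sq, intervalIntegral.integral_neg]
    rw [intervalIntegral.integral_comp_sub_left (fun u => q u),
      intervalIntegral.integral_comp_sub_left (fun u => q u ^ 2)]
    simp
  · have := (hconc.comp_affineMap f).neg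
    refine (this.subset ?_ ((convex_Ioo 0 1).inter (convex_Ici _))).congr ?_
    · rintro u ⟨⟨h1, h2⟩, h3⟩
      simp only [mem_preimage, hf, mem_inter_iff, mem_Ioo, mem_Iic]
      simp only [mem_Ici] at h3
      exact ⟨⟨by linarith, by linarith⟩, by linarith⟩
    · intro u _
      simp [hf]
  · have := (hconv.comp_affineMap f).neg
    refine (this.subset ?_ ((convex_Ioo 0 1).inter (convex_Iic _))).congr ?_
    · rintro u ⟨⟨h1, h2⟩, h3⟩
      simp only [mem_preimage, hf, mem_inter_iff, mem_Ioo, mem_Ici]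
      simp only [mem_Iic] at h3
      exact ⟨⟨by linarith, by linarith⟩, by linarith⟩
    · intro u _
      simp [hf]

section RandomVariables

variable {Ω : Type*} [MeasurableSpace Ω]

/-! ### Extremal laws and the lower bound -/

/-- The distribution function of `k * V + d`, for `k > 0` and a uniform variable on `[0,1]` that is
truncated to `V ∈ [b₁,b₂]`, if all mass outside `[b₁,b₂]` is moved to the nearest endpoint. -/
def clampedDist (b₁ b₂ k d x : ℝ) : ℝ :=
  if x < k * b₁ + d then 0 else if k * b₂ + d ≤ x then 1 else (x - d) / k

lemma tailFun_eq (P : Measure Ω) [IsProbabilityMeasure P] {X : Ω → ℝ} (hX : Measurable X)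
    (x : ℝ) : tailFun P X x = 1 - distFun P X x := by
  have h : {ω | x < X ω} = {ω | X ω ≤ x}ᶜ := by ext; simp
  have hm : MeasurableSet {ω | X ω ≤ x} := hX measurableSet_Iic
  rw [tailFun, distFun, h, probReal_compl_eq_one_sub hm]

/-- The substitution `x = k * u + d`. The values of `g` outside the interval of integration vanish
as `g 0 = g 1 = 0`. -/
lemma entropy_of_distFun_eq {g : ℝ → ℝ} (hg : IsDistortion g) (hg1 : g 1 = 0) (P : Measure Ω)
    [IsProbabilityMeasure P] {X : Ω → ℝ} (hX : Measurable X) {b₁ b₂ k d : ℝ} (h0 : 0 ≤ b₁)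
    (h12 : b₁ ≤ b₂) (h1 : b₂ ≤ 1) (hk : 0 < k)
    (hF : ∀ x, distFun P X x = clampedDist b₁ b₂ k d x) :
    EntropyDefined g P X ∧
      entropy g P X = ((-(k * ∫ u in b₁..b₂, gHat g u) : ℝ) : EReal) := by
  have hle : k * b₁ + d ≤ k * b₂ + d := by
    have := mul_le_mul_of_nonneg_left h12 hk.le
    linarith
  have hH : (fun x => g (tailFun P X x)) =
      (Ico (k * b₁ + d) (k * b₂ + d)).indicator fun x => -gHat g ((x - d) / k) := by
    funext x
    rw [tailFun_eq P hX, hF, clampedDist]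
    split_ifs with h h'
    · rw [indicator_of_notMem (fun hx => absurd hx.1 (not_le.2 h)), sub_zero, hg1]
    · rw [indicator_of_notMem (fun hx => absurd hx.2 (not_lt.2 h')), sub_self, hg.2]
    · rw [indicator_of_mem (show x ∈ Ico _ _ from ⟨not_lt.1 h, not_le.1 h'⟩), gHat, neg_neg]
  have hii : IntervalIntegrable (fun x => -gHat g ((x - d) / k)) volume
      (k * b₁ + d) (k * b₂ + d) := by
    obtain ⟨p, q, hp, hq, hpq⟩ := exists_monotoneOn_gHat hg
    have hm : ∀ x ∈ Icc (k * b₁ + d) (k * b₂ + d), (x - d) / k ∈ Icc (0 : ℝ) 1 := by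
      intro x hx
      have ha : b₁ ≤ (x - d) / k := by rw [le_div_iff₀ hk]; linarith [hx.1]
      have hb : (x - d) / k ≤ b₂ := by rw [div_le_iff₀ hk]; linarith [hx.2]
      exact ⟨h0.trans ha, hb.trans h1⟩
    have hmono : ∀ p : ℝ → ℝ, MonotoneOn p (Icc 0 1) →
        IntervalIntegrable (fun x => p ((x - d) / k)) volume (k * b₁ + d) (k * b₂ + d) := by
      intro p hp
      refine MonotoneOn.intervalIntegrable ?_
      rw [uIcc_of_le hle]
      exact fun x hx y hy hxy => hp (hm x hx) (hm y hy) (by gcongr)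
    have : (fun x => -gHat g ((x - d) / k)) =
        fun x => -(p ((x - d) / k) - q ((x - d) / k)) := by
      funext x; rw [hpq, Pi.sub_apply]
    rw [this]
    exact ((hmono p hp).sub (hmono q hq)).neg
  have hint : Integrable (fun x => g (tailFun P X x)) := by
    rw [hH, integrable_indicator_iff measurableSet_Ico, ← integrableOn_Icc_iff_integrableOn_Ico,
      ← intervalIntegrable_iff_integrableOn_Icc_of_le hle]
    exact hii
  have hval : ∫ x, g (tailFun P X x) = -(k * ∫ u in b₁..b₂, gHat g u) := by
    rw [hH, integral_indicator measurableSet_Ico, integral_Ico_eq_integral_Ioc,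
      ← intervalIntegral.integral_of_le hle, intervalIntegral.integral_neg]
    simp only [sub_div]
    rw [intervalIntegral.integral_comp_div_sub _ hk.ne', smul_eq_mul]
    have e1 : (k * b₁ + d) / k - d / k = b₁ := by field_simp; ring
    have e2 : (k * b₂ + d) / k - d / k = b₂ := by field_simp; ring
    rw [e1, e2]
  have hpos : entropyPos g P X ≠ ⊤ := hint.lintegral_lt_top.ne
  have hneg : entropyNeg g P X ≠ ⊤ := hint.neg.lintegral_lt_top.ne
  refine ⟨Or.inl hpos, ?_⟩
  rw [← hval, integral_eq_lintegral_pos_part_sub_lintegral_neg_part hint, EReal.coe_sub, entropy]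
  rw [← EReal.coe_ennreal_toReal hpos, ← EReal.coe_ennreal_toReal hneg]
  rfl

section Uniform

variable {P : Measure Ω} {U : Ω → ℝ}

lemma measureReal_uniform_le (hU : Measurable U) (hmap : P.map U = volume.restrict (Ioc 0 1))
    {y : ℝ} (hy0 : 0 ≤ y) (hy1 : y ≤ 1) : P.real {ω | U ω ≤ y} = y := by
  have h : P {ω | U ω ≤ y} = P.map U (Iic y) := (Measure.map_apply hU measurableSet_Iic).symm
  have h2 : Iic y ∩ Ioc (0 : ℝ) 1 = Ioc 0 y := by
    ext x
    simp only [mem_inter_iff, mem_Iic, mem_Ioc]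
    constructor
    · rintro ⟨h, h', -⟩; exact ⟨h', h⟩
    · rintro ⟨h, h'⟩; exact ⟨h', h, h'.trans hy1⟩
  rw [measureReal_def, h, hmap, Measure.restrict_apply measurableSet_Iic, h2, Real.volume_Ioc,
    sub_zero, ENNReal.toReal_ofReal hy0]

lemma integral_comp_uniform (hU : Measurable U) (hmap : P.map U = volume.restrict (Ioc 0 1))
    {f : ℝ → ℝ} (hf : Continuous f) : ∫ ω, f (U ω) ∂P = ∫ u in (0 : ℝ)..1, f u := by
  rw [intervalIntegral.integral_of_le zero_le_one, ← hmap,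
    integral_map hU.aemeasurable hf.aestronglyMeasurable]

lemma memLp_comp_uniform (hU : Measurable U) (hmap : P.map U = volume.restrict (Ioc 0 1))
    {f : ℝ → ℝ} (hf : Continuous f) : MemLp (fun ω => f (U ω)) 2 P := by
  have h : MemLp f 2 (P.map U) := by
    rw [hmap]
    obtain ⟨C, hC⟩ := isCompact_Icc.exists_bound_of_continuousOn (s := Icc (0 : ℝ) 1)
      hf.continuousOn
    refine MemLp.of_bound hf.aestronglyMeasurable C ?_
    filter_upwards [ae_restrict_mem measurableSet_Ioc] with u hu using hC u ⟨hu.1.le, hu.2⟩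
  exact h.comp_of_map hU.aemeasurable

lemma moments_hinge_uniform [IsProbabilityMeasure P] (hU : Measurable U)
    (hmap : P.map U = volume.restrict (Ioc 0 1))
    {c a l r : ℝ} (hc0 : 0 ≤ c) (hc1 : c ≤ 1) :
    ∫ ω, hinge c a l r (U ω) ∂P = a - l * c ^ 2 / 2 + r * (1 - c) ^ 2 / 2 ∧
      variance (fun ω => hinge c a l r (U ω)) P =
        (a ^ 2 - a * l * c ^ 2 + l ^ 2 * c ^ 3 / 3 + a * r * (1 - c) ^ 2 + r ^ 2 * (1 - c) ^ 3 / 3) -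
          (a - l * c ^ 2 / 2 + r * (1 - c) ^ 2 / 2) ^ 2 := by
  have hc := continuous_hinge c a l r
  have h1 : ∫ ω, hinge c a l r (U ω) ∂P = a - l * c ^ 2 / 2 + r * (1 - c) ^ 2 / 2 := by
    rw [integral_comp_uniform hU hmap hc]
    have := integral_hinge_mul_hinge hc0 hc1 1 0 0 a l r
    have h3 : ∀ u, hinge c 1 0 0 u = 1 := fun u => by simp [hinge]
    simp only [h3, one_mul] at this
    rw [this]
    ring
  refine ⟨h1, ?_⟩
  rw [variance_eq_sub (memLp_comp_uniform hU hmap hc), h1]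
  congr 1
  have h2 : ∫ ω, hinge c a l r (U ω) ^ 2 ∂P = ∫ u in (0 : ℝ)..1, hinge c a l r u ^ 2 :=
    integral_comp_uniform hU hmap (hc.pow 2)
  simp only [Pi.pow_apply]
  rw [h2]
  simp only [sq (hinge _ _ _ _ _)]
  rw [integral_hinge_mul_hinge hc0 hc1]
  ring

lemma distFun_max_uniform [IsProbabilityMeasure P] (hU : Measurable U)
    (hmap : P.map U = volume.restrict (Ioc 0 1))
    {b k d : ℝ} (hb0 : 0 ≤ b) (hk : 0 < k) (x : ℝ) :
    distFun P (fun ω => hinge b (k * b + d) 0 k (U ω)) x = clampedDist b 1 k d x := by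
  have hset : {ω | hinge b (k * b + d) 0 k (U ω) ≤ x} =
      {ω | b ≤ (x - d) / k ∧ U ω ≤ (x - d) / k} := by
    ext ω
    simp only [mem_ofPred_eq, hinge, zero_mul, add_zero, le_div_iff₀ hk]
    rcases le_total (U ω) b with h | h
    · rw [max_eq_right (by linarith)]
      have := mul_le_mul_of_nonneg_right h hk.le
      constructor
      · intro h; constructor <;> linarith
      · rintro ⟨h, -⟩; linarith
    · rw [max_eq_left (by linarith)]
      have := mul_le_mul_of_nonneg_right h hk.le
      constructor
      · intro h; constructor <;> linarith
      · rintro ⟨-, h⟩; linarith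
  rw [distFun, hset, clampedDist]
  split_ifs with h h'
  · have hb : ¬ b ≤ (x - d) / k := by rw [not_le, div_lt_iff₀ hk]; linarith
    simp [hb]
  · have hb : 1 ≤ (x - d) / k := by rw [le_div_iff₀ hk]; linarith
    have h1 := measureReal_uniform_le hU hmap zero_le_one le_rfl
    refine le_antisymm measureReal_le_one (h1.symm.le.trans (measureReal_mono fun ω hω => ?_))
    refine ⟨?_, le_trans hω hb⟩
    rw [le_div_iff₀ hk]; linarith
  · have hb : b ≤ (x - d) / k := by rw [le_div_iff₀ hk]; linarith
    have hb1 : (x - d) / k ≤ 1 := by rw [div_le_iff₀ hk]; linarith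
    simp only [hb, true_and]
    exact measureReal_uniform_le hU hmap (hb0.trans hb) hb1

lemma distFun_min_uniform [IsProbabilityMeasure P] (hU : Measurable U)
    (hmap : P.map U = volume.restrict (Ioc 0 1))
    {b k d : ℝ} (hb0 : 0 ≤ b) (hb1 : b ≤ 1) (hk : 0 < k) (x : ℝ) :
    distFun P (fun ω => hinge b (k * b + d) k 0 (U ω)) x = clampedDist 0 b k d x := by
  have hset : {ω | hinge b (k * b + d) k 0 (U ω) ≤ x} =
      {ω | b ≤ (x - d) / k ∨ U ω ≤ (x - d) / k} := by
    ext ω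
    simp only [mem_ofPred_eq, hinge, zero_mul, add_zero, le_div_iff₀ hk]
    rcases le_total (U ω) b with h | h
    · rw [min_eq_left (by linarith)]
      have := mul_le_mul_of_nonneg_right h hk.le
      constructor
      · intro h; right; linarith
      · rintro (h | h) <;> linarith
    · rw [min_eq_right (by linarith)]
      have := mul_le_mul_of_nonneg_right h hk.le
      constructor
      · intro h; left; linarith
      · rintro (h | h) <;> linarith
  rw [distFun, hset, clampedDist]
  split_ifs with h h'
  · have hx : (x - d) / k < 0 := by rw [div_lt_iff₀ hk]; linarith
    have hb : ¬ b ≤ (x - d) / k := not_le.2 (hx.trans_le hb0)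
    simp only [hb, false_or]
    refine le_antisymm ?_ measureReal_nonneg
    rw [← measureReal_uniform_le hU hmap le_rfl zero_le_one]
    exact measureReal_mono fun ω hω => le_trans hω hx.le
  · have hb : b ≤ (x - d) / k := by rw [le_div_iff₀ hk]; linarith
    simp [hb]
  · have hb : ¬ b ≤ (x - d) / k := by rw [not_le, div_lt_iff₀ hk]; linarith
    have h0 : 0 ≤ (x - d) / k := by rw [le_div_iff₀ hk]; linarith
    simp only [hb, false_or]
    exact measureReal_uniform_le hU hmap h0 ((not_le.1 hb).le.trans hb1)

end Uniform

lemma convexOn_concaveOn_sub_div (s : Set ℝ) (hs : Convex ℝ s) (k d : ℝ) :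
    ConvexOn ℝ s (fun x => (x - d) / k) ∧ ConcaveOn ℝ s (fun x => (x - d) / k) := by
  constructor <;> refine ⟨hs, fun x _ y _ a b _ _ hab => le_of_eq ?_⟩ <;>
  · simp only [smul_eq_mul]
    rw [← eq_sub_iff_add_eq'] at hab
    subst hab
    ring

lemma isUnimodal_of_clampedDist_zero_left {P : Measure Ω} {X : Ω → ℝ} {b k d : ℝ} (hb : 0 ≤ b)
    (hk : 0 < k) (hF : ∀ x, distFun P X x = clampedDist 0 b k d x) : IsUnimodal P X := by
  refine ⟨k * b + d, ?_, ?_⟩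
  · refine ((convexOn_const 0 (convex_Iio _)).sup
      (convexOn_concaveOn_sub_div _ (convex_Iio _) k d).1).congr ?_
    intro x hx
    simp only [mem_Iio] at hx
    rw [hF, clampedDist, Pi.sup_apply]
    split_ifs with h h'
    · exact sup_eq_left.2 (div_nonpos_of_nonpos_of_nonneg (by linarith) hk.le)
    · exact absurd hx (not_lt.2 h')
    · exact sup_eq_right.2 (div_nonneg (by linarith) hk.le)
  · refine (concaveOn_const 1 (convex_Ioi _)).congr fun x hx => ?_
    simp only [mem_Ioi] at hx
    have := mul_nonneg hk.le hb
    rw [hF, clampedDist, if_neg (by linarith), if_pos hx.le]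

lemma isUnimodal_of_clampedDist_one_right {P : Measure Ω} {X : Ω → ℝ} {b k d : ℝ}
    (hk : 0 < k) (hF : ∀ x, distFun P X x = clampedDist b 1 k d x) : IsUnimodal P X := by
  refine ⟨k * b + d, ?_, ?_⟩
  · refine (convexOn_const 0 (convex_Iio _)).congr fun x hx => ?_
    simp only [mem_Iio] at hx
    rw [hF, clampedDist, if_pos hx]
  · refine ((concaveOn_const 1 (convex_Ioi _)).inf
      (convexOn_concaveOn_sub_div _ (convex_Ioi _) k d).2).congr ?_
    intro x hx
    simp only [mem_Ioi] at hx
    rw [hF, clampedDist, Pi.inf_apply, if_neg (by linarith)]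
    split_ifs with h'
    · exact inf_eq_left.2 (by rw [le_div_iff₀ hk]; linarith)
    · exact inf_eq_right.2 (by rw [div_le_iff₀ hk]; linarith)

/-- The value `Λ_R b` is attained by the law with quantile function `μ' + k * max (u - b) 0`. -/
lemma exists_entropy_eq_LambdaR {P : Measure Ω} [IsProbabilityMeasure P] (hP : Atomless P)
    {g : ℝ → ℝ} (hg : IsDistortion g) (hg1 : g 1 = 0) (μ : ℝ) {σ : ℝ} (hσ : 0 < σ) {b : ℝ}
    (hb : b ∈ Ico (0 : ℝ) 1) :
    ∃ X ∈ unimodalClass P μ σ, EntropyDefined g P X ∧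
      entropy g P X = ((σ * LambdaR g b : ℝ) : EReal) := by
  obtain ⟨U, hU, hmap⟩ := exists_uniform_of_atomless P hP
  obtain ⟨hb0, hb1⟩ := hb
  obtain ⟨D, hD⟩ : ∃ D, D = (1 - b) ^ 3 * (1 / 3 + b) := ⟨_, rfl⟩
  have hD0 : 0 < D := by
    rw [hD]; exact mul_pos (pow_pos (by linarith) 3) (by linarith)
  obtain ⟨k, hk⟩ : ∃ k, k = 2 * σ / √D := ⟨_, rfl⟩
  have hk0 : 0 < k := by rw [hk]; positivity
  have hkD : k ^ 2 * D = 4 * σ ^ 2 := by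
    rw [hk, div_pow, Real.sq_sqrt hD0.le]; field_simp; ring
  -- this shift makes the mean equal to `μ`
  obtain ⟨d, hd⟩ : ∃ d, d = μ - k * (1 - b) ^ 2 / 2 - k * b := ⟨_, rfl⟩
  have hmom := moments_hinge_uniform hU hmap (a := k * b + d) (l := 0) (r := k) hb0 hb1.le
  have hF := distFun_max_uniform hU hmap (d := d) hb0 hk0
  have hXm : Measurable fun ω => hinge b (k * b + d) 0 k (U ω) :=
    (continuous_hinge _ _ _ _).measurable.comp hU
  obtain ⟨hdef, hent⟩ := entropy_of_distFun_eq hg hg1 P hXm hb0 hb1.le le_rfl hk0 hF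
  refine ⟨_, ⟨hXm, memLp_comp_uniform hU hmap (continuous_hinge _ _ _ _), ?_, ?_,
    isUnimodal_of_clampedDist_one_right hk0 hF⟩, hdef, ?_⟩
  · rw [hmom.1, hd]; ring
  · rw [hmom.2]
    have : k ^ 2 * D = k ^ 2 * ((1 - b) ^ 3 * (1 / 3 + b)) := by rw [hD]
    rw [hkD] at this
    linear_combination -this / 4
  · rw [hent, LambdaR, rsIntegral_gHat hg hb1.le hb0 le_rfl, ← hD]
    have hg0 : gHat g 1 = 0 := by simp [gHat, hg.2]
    rw [hg0, hk]
    norm_cast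
    field_simp
    ring

/-- The value `Λ_L b` is attained by the law with quantile function `μ' + k * min (u - b) 0`. -/
lemma exists_entropy_eq_LambdaL {P : Measure Ω} [IsProbabilityMeasure P] (hP : Atomless P)
    {g : ℝ → ℝ} (hg : IsDistortion g) (hg1 : g 1 = 0) (μ : ℝ) {σ : ℝ} (hσ : 0 < σ) {b : ℝ}
    (hb : b ∈ Ioc (0 : ℝ) 1) :
    ∃ X ∈ unimodalClass P μ σ, EntropyDefined g P X ∧
      entropy g P X = ((σ * LambdaL g b : ℝ) : EReal) := by
  obtain ⟨U, hU, hmap⟩ := exists_uniform_of_atomless P hP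
  obtain ⟨hb0, hb1⟩ := hb
  obtain ⟨D, hD⟩ : ∃ D, D = b ^ 3 * (4 - 3 * b) := ⟨_, rfl⟩
  have hD0 : 0 < D := by
    rw [hD]; exact mul_pos (pow_pos hb0 3) (by linarith)
  obtain ⟨k, hk⟩ : ∃ k, k = 2 * √3 * σ / √D := ⟨_, rfl⟩
  have hk0 : 0 < k := by rw [hk]; positivity
  have hkD : k ^ 2 * D = 12 * σ ^ 2 := by
    rw [hk, div_pow, Real.sq_sqrt hD0.le, mul_pow, mul_pow, Real.sq_sqrt (by norm_num)]
    field_simp; ring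
  -- this shift makes the mean equal to `μ`
  obtain ⟨d, hd⟩ : ∃ d, d = μ + k * b ^ 2 / 2 - k * b := ⟨_, rfl⟩
  have hmom := moments_hinge_uniform hU hmap (a := k * b + d) (l := k) (r := 0) hb0.le hb1
  have hF := distFun_min_uniform hU hmap (d := d) hb0.le hb1 hk0
  have hXm : Measurable fun ω => hinge b (k * b + d) k 0 (U ω) :=
    (continuous_hinge _ _ _ _).measurable.comp hU
  obtain ⟨hdef, hent⟩ := entropy_of_distFun_eq hg hg1 P hXm le_rfl hb0.le hb1 hk0 hF
  refine ⟨_, ⟨hXm, memLp_comp_uniform hU hmap (continuous_hinge _ _ _ _), ?_, ?_,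
    isUnimodal_of_clampedDist_zero_left hb0.le hk0 hF⟩, hdef, ?_⟩
  · rw [hmom.1, hd]; ring
  · rw [hmom.2]
    have : k ^ 2 * D = k ^ 2 * (b ^ 3 * (4 - 3 * b)) := by rw [hD]
    rw [hkD] at this
    linear_combination -this / 12
  · rw [hent, LambdaL, rsIntegral_gHat hg hb0.le le_rfl hb1, ← hD, hk]
    norm_cast
    field_simp
    ring

lemma entropy_of_ae_const {P : Measure Ω} [IsProbabilityMeasure P] {g : ℝ → ℝ} (hg0 : g 0 = 0)
    (hg1 : g 1 = 0) {X : Ω → ℝ} {μ : ℝ} (hX : X =ᵐ[P] fun _ => μ) :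
    entropyPos g P X = 0 ∧ entropyNeg g P X = 0 := by
  have h : ∀ x, g (tailFun P X x) = 0 := by
    intro x
    have : P {ω | x < X ω} = P {_ω | x < μ} := by
      refine measure_congr ?_
      filter_upwards [hX] with ω hω
      change (x < X ω) = (x < μ)
      rw [hω]
    rw [tailFun, measureReal_def, this]
    by_cases hx : x < μ <;> simp [hx, hg0, hg1]
  simp [entropyPos, entropyNeg, h]

lemma const_mem_unimodalClass (P : Measure Ω) [IsProbabilityMeasure P] (μ : ℝ) :
    (fun _ => μ) ∈ unimodalClass P μ 0 := by
  refine ⟨measurable_const, memLp_const μ, by simp, by simp [variance_eq_integral], μ, ?_, ?_⟩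
  · refine (convexOn_const 0 (convex_Iio _)).congr fun x hx => ?_
    simp [distFun, not_le.2 (mem_Iio.1 hx)]
  · refine (concaveOn_const 1 (convex_Ioi _)).congr fun x hx => ?_
    simp [distFun, (mem_Ioi.1 hx).le]

theorem mul_supLambda_le_worstCaseEntropy {P : Measure Ω} [IsProbabilityMeasure P]
    (hP : Atomless P) {g : ℝ → ℝ} (hg : IsDistortion g) (hg1 : g 1 = 0) (μ : ℝ) {σ : ℝ}
    (hσ : 0 ≤ σ) : (σ : EReal) * supLambda g ≤ worstCaseEntropy g P μ σ := by
  have hle : ∀ X ∈ unimodalClass P μ σ, EntropyDefined g P X →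
      entropy g P X ≤ worstCaseEntropy g P μ σ := fun X hX hd =>
    le_iSup₂ (f := fun X (_ : X ∈ {X ∈ unimodalClass P μ σ | EntropyDefined g P X}) =>
      entropy g P X) X ⟨hX, hd⟩
  rcases hσ.eq_or_lt with rfl | hσ
  · obtain ⟨h1, h2⟩ := entropy_of_ae_const (P := P) hg.2 hg1 (X := fun _ => μ) (μ := μ)
      Filter.EventuallyEq.rfl
    have := hle _ (const_mem_unimodalClass P μ) (Or.inl (by simp [h1]))
    simpa [entropy, h1, h2] using this
  · have hσ' : (0 : EReal) < (σ : EReal) := by exact_mod_cast hσ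
    rw [mul_comm, ← EReal.le_div_iff_mul_le hσ' (EReal.coe_ne_top σ)]
    refine max_le (iSup₂_le fun b hb => ?_) (iSup₂_le fun b hb => ?_)
    · obtain ⟨X, hX, hd, he⟩ := exists_entropy_eq_LambdaR hP hg hg1 μ hσ hb
      rw [EReal.le_div_iff_mul_le hσ' (EReal.coe_ne_top σ), mul_comm, ← EReal.coe_mul, ← he]
      exact hle X hX hd
    · obtain ⟨X, hX, hd, he⟩ := exists_entropy_eq_LambdaL hP hg hg1 μ hσ hb
      rw [EReal.le_div_iff_mul_le hσ' (EReal.coe_ne_top σ), mul_comm, ← EReal.coe_mul, ← he]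
      exact hle X hX hd

/-! ### Quantile functions of unimodal random variables -/

/-- The lower quantile function `q u = inf {x | u ≤ F x}` of `X`; only its values on `(0,1)`, where
the set is nonempty and bounded below, are meaningful. -/
def quantile (P : Measure Ω) (X : Ω → ℝ) (u : ℝ) : ℝ := sInf {x | u ≤ distFun P X x}

section QuantileFunction

variable {P : Measure Ω} [IsProbabilityMeasure P] {X : Ω → ℝ}

lemma distFun_eq_cdf (hX : Measurable X) : distFun P X = cdf (P.map X) := by
  have : IsProbabilityMeasure (P.map X) := Measure.isProbabilityMeasure_map hX.aemeasurable
  funext x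
  rw [cdf_eq_real, map_measureReal_apply hX measurableSet_Iic]
  rfl

lemma monotone_distFun (hX : Measurable X) : Monotone (distFun P X) := by
  rw [distFun_eq_cdf hX]; exact (cdf _).mono

lemma quantile_le_iff (hX : Measurable X) {u : ℝ} (hu : u ∈ Ioo (0 : ℝ) 1) (x : ℝ) :
    quantile P X u ≤ x ↔ u ≤ distFun P X x := by
  have hne : {x | u ≤ distFun P X x}.Nonempty := by
    rw [distFun_eq_cdf hX]
    obtain ⟨y, hy⟩ := ((tendsto_order.1 (tendsto_cdf_atTop (P.map X))).1 u hu.2).exists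
    exact ⟨y, hy.le⟩
  have hbdd : BddBelow {x | u ≤ distFun P X x} := by
    obtain ⟨y, hy⟩ := ((tendsto_order.1 (tendsto_cdf_atBot (P.map X))).2 u hu.1).exists
    refine ⟨y, fun z hz => ?_⟩
    by_contra h
    rw [mem_ofPred_eq] at hz
    have := monotone_distFun (P := P) hX (not_le.1 h).le
    rw [← distFun_eq_cdf hX] at hy
    linarith
  refine ⟨fun h => ?_, fun h => csInf_le hbdd h⟩
  have hcont := (cdf (P.map X)).right_continuous x
  rw [← distFun_eq_cdf hX] at hcont
  have hcont' : Filter.Tendsto (distFun P X) (nhdsWithin x (Ioi x)) (nhds (distFun P X x)) :=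
    hcont.mono_left (nhdsWithin_mono _ Ioi_subset_Ici_self)
  refine ge_of_tendsto hcont' ?_
  filter_upwards [self_mem_nhdsWithin] with z hz
  obtain ⟨y, hy, hyz⟩ := exists_lt_of_csInf_lt hne (lt_of_le_of_lt h hz)
  exact le_trans hy (monotone_distFun hX hyz.le)

lemma lt_quantile_iff (hX : Measurable X) {u : ℝ} (hu : u ∈ Ioo (0 : ℝ) 1) (x : ℝ) :
    x < quantile P X u ↔ distFun P X x < u := by
  rw [← not_le, quantile_le_iff hX hu, not_le]

lemma monotoneOn_quantile (hX : Measurable X) : MonotoneOn (quantile P X) (Ioo 0 1) :=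
  fun _ hu _ hv huv => (quantile_le_iff hX hu _).2 (huv.trans ((quantile_le_iff hX hv _).1 le_rfl))

/-- Under Lebesgue measure on `(0,1)` the quantile function has the law of `X`. -/
lemma identDistrib_quantile (hX : Measurable X) :
    IdentDistrib (quantile P X) X (volume.restrict (Ioo 0 1)) P := by
  have hq : AEMeasurable (quantile P X) (volume.restrict (Ioo 0 1)) :=
    aemeasurable_restrict_of_monotoneOn measurableSet_Ioo (monotoneOn_quantile hX)
  refine ⟨hq, hX.aemeasurable, ?_⟩
  have : IsProbabilityMeasure (P.map X) := Measure.isProbabilityMeasure_map hX.aemeasurable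
  refine (Measure.ext_of_Iic _ _ fun x => ?_).symm
  rw [Measure.map_apply_of_aemeasurable hq measurableSet_Iic,
    Measure.restrict_apply' measurableSet_Ioo, ← ofReal_cdf, ← distFun_eq_cdf hX]
  have h1 : distFun P X x ≤ 1 := measureReal_le_one
  have hset : quantile P X ⁻¹' Iic x ∩ Ioo 0 1 = Iic (distFun P X x) ∩ Ioo 0 1 := by
    ext u
    simp only [mem_inter_iff, mem_preimage, mem_Iic]
    exact and_congr_left fun hu => quantile_le_iff hX hu x
  rw [hset]
  refine le_antisymm ?_ ?_
  · rw [← sub_zero (distFun P X x), ← Real.volume_Ioo]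
    exact measure_mono fun u hu => ⟨by simpa using hu.2.le, hu.1, hu.2.trans_le (by simpa using h1)⟩
  · rw [← sub_zero (distFun P X x), ← Real.volume_Ioc]
    exact measure_mono fun u hu => ⟨hu.2.1, by simpa using hu.1⟩

/-- At a level `u = F x₀` this needs the convexity of `F` below the mode `x₀`: it excludes that `F`
is constant on an interval to the left of `x₀`, unless `F = 0` there. -/
lemma le_quantile_of_distFun_le (hX : Measurable X) {x₀ : ℝ}
    (hconv : ConvexOn ℝ (Iio x₀) (distFun P X)) {u : ℝ} (hu : u ∈ Ioo (0 : ℝ) 1)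
    (h : distFun P X x₀ ≤ u) : x₀ ≤ quantile P X u := by
  rcases h.lt_or_eq with h | h
  · exact ((lt_quantile_iff hX hu _).2 h).le
  by_contra hlt
  push Not at hlt
  obtain ⟨z, hz⟩ := ((tendsto_order.1 (tendsto_cdf_atBot (P.map X))).2 u hu.1).exists
  rw [← distFun_eq_cdf hX] at hz
  have hzq : z < quantile P X u := (lt_quantile_iff hX hu z).2 hz
  have hq : u ≤ distFun P X (quantile P X u) := (quantile_le_iff hX hu _).1 le_rfl
  have hm : distFun P X ((quantile P X u + x₀) / 2) ≤ u := by
    refine (monotone_distFun hX ?_).trans h.le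
    linarith
  have := hconv.slope_mono_adjacent (hzq.trans hlt)
    (show (quantile P X u + x₀) / 2 ∈ Iio x₀ by rw [mem_Iio]; linarith) hzq
    (by linarith : quantile P X u < (quantile P X u + x₀) / 2)
  have h1 : 0 < (distFun P X (quantile P X u) - distFun P X z) / (quantile P X u - z) :=
    div_pos (by linarith) (by linarith)
  have h2 : (distFun P X ((quantile P X u + x₀) / 2) - distFun P X (quantile P X u)) /
      ((quantile P X u + x₀) / 2 - quantile P X u) ≤ 0 :=
    div_nonpos_of_nonpos_of_nonneg (by linarith) (by linarith)
  linarith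

lemma concaveOn_quantile (hX : Measurable X) {x₀ : ℝ}
    (hconv : ConvexOn ℝ (Iio x₀) (distFun P X)) :
    ConcaveOn ℝ (Ioo 0 1 ∩ Iic (distFun P X x₀)) (quantile P X) := by
  have hcvx : Convex ℝ (Ioo 0 1 ∩ Iic (distFun P X x₀)) := (convex_Ioo 0 1).inter (convex_Iic _)
  refine ⟨hcvx, fun u hu v hv a b ha hb hab => ?_⟩
  have hw := (hcvx hu hv ha hb hab).1
  simp only [smul_eq_mul] at hw ⊢
  by_contra hlt
  push Not at hlt
  obtain ⟨δ, hδ⟩ : ∃ δ, δ = a * quantile P X u + b * quantile P X v -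
    quantile P X (a * u + b * v) := ⟨_, rfl⟩
  have hδ0 : 0 < δ := by linarith
  have hxu : quantile P X u ≤ x₀ := (quantile_le_iff hX hu.1 _).2 hu.2
  have hxv : quantile P X v ≤ x₀ := (quantile_le_iff hX hv.1 _).2 hv.2
  have hFu := (lt_quantile_iff (P := P) hX hu.1 (quantile P X u - δ)).1 (by linarith)
  have hFv := (lt_quantile_iff (P := P) hX hv.1 (quantile P X v - δ)).1 (by linarith)
  have hFw := (quantile_le_iff (P := P) hX hw _).1 le_rfl
  have hc := hconv.2 (show quantile P X u - δ ∈ Iio x₀ by rw [mem_Iio]; linarith)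
    (show quantile P X v - δ ∈ Iio x₀ by rw [mem_Iio]; linarith) ha hb hab
  have hy : a * (quantile P X u - δ) + b * (quantile P X v - δ) =
      quantile P X (a * u + b * v) := by
    have : (a + b) * δ = δ := by rw [hab, one_mul]
    linarith
  simp only [smul_eq_mul] at hc
  rw [hy] at hc
  rcases ha.eq_or_lt with rfl | ha
  · have : b = 1 := by linarith
    subst this
    linarith
  · have h1 := mul_lt_mul_of_pos_left hFu ha
    have h2 := mul_le_mul_of_nonneg_left hFv.le hb
    linarith

lemma convexOn_quantile (hX : Measurable X) {x₀ : ℝ}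
    (hconv : ConvexOn ℝ (Iio x₀) (distFun P X)) (hconc : ConcaveOn ℝ (Ioi x₀) (distFun P X)) :
    ConvexOn ℝ (Ioo 0 1 ∩ Ici (distFun P X x₀)) (quantile P X) := by
  have hcvx : Convex ℝ (Ioo 0 1 ∩ Ici (distFun P X x₀)) := (convex_Ioo 0 1).inter (convex_Ici _)
  refine ⟨hcvx, fun u hu v hv a b ha hb hab => ?_⟩
  have hw := (hcvx hu hv ha hb hab).1
  simp only [smul_eq_mul] at hw ⊢
  by_contra hlt
  push Not at hlt
  obtain ⟨y, hy1, hy2⟩ := exists_between hlt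
  obtain ⟨δ, hδ⟩ : ∃ δ, δ = y - (a * quantile P X u + b * quantile P X v) := ⟨_, rfl⟩
  have hδ0 : 0 < δ := by linarith
  have hxu := le_quantile_of_distFun_le hX hconv hu.1 hu.2
  have hxv := le_quantile_of_distFun_le hX hconv hv.1 hv.2
  have hFu : u ≤ distFun P X (quantile P X u + δ) :=
    (quantile_le_iff (P := P) hX hu.1 _).1 (by linarith)
  have hFv : v ≤ distFun P X (quantile P X v + δ) :=
    (quantile_le_iff (P := P) hX hv.1 _).1 (by linarith)
  have hFw := (lt_quantile_iff (P := P) hX hw _).1 hy2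
  have hc := hconc.2 (show quantile P X u + δ ∈ Ioi x₀ by rw [mem_Ioi]; linarith)
    (show quantile P X v + δ ∈ Ioi x₀ by rw [mem_Ioi]; linarith) ha hb hab
  have hy : a * (quantile P X u + δ) + b * (quantile P X v + δ) = y := by
    have : (a + b) * δ = δ := by rw [hab, one_mul]
    linarith
  simp only [smul_eq_mul] at hc
  rw [hy] at hc
  have h1 := mul_le_mul_of_nonneg_left hFu ha
  have h2 := mul_le_mul_of_nonneg_left hFv hb
  linarith

end QuantileFunction

end RandomVariables

open Filter Topology

/-! ### The Green representation of the convex envelope -/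

lemma gHat_bounded_below {g : ℝ → ℝ} (hg : IsDistortion g) :
    ∀ v ∈ Icc (0 : ℝ) 1, -(eVariationOn g (Icc 0 1)).toReal ≤ gHat g v := by
  intro v hv
  have h1 : (1 - v) ∈ Icc (0 : ℝ) 1 := ⟨by linarith [hv.2], by linarith [hv.1]⟩
  have h2 := hg.1.sub_le h1 (⟨le_rfl, zero_le_one⟩ : (0 : ℝ) ∈ Icc (0 : ℝ) 1)
  rw [hg.2] at h2
  simp only [gHat]
  linarith

lemma convexEnvelope_le {f : ℝ → ℝ} {m : ℝ} (hm : ∀ v ∈ Icc (0 : ℝ) 1, m ≤ f v) {v : ℝ}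
    (hv : v ∈ Icc (0 : ℝ) 1) : convexEnvelope f v ≤ f v := by
  refine csSup_le ⟨m, fun _ => m, convexOn_const m (convex_Icc 0 1), hm, rfl⟩ ?_
  rintro _ ⟨h, -, hle, rfl⟩
  exact hle v hv

/-- At an endpoint `e` the envelope is not below `0`, as the function that is `0` at both endpoints
and `m` in between is a convex minorant. -/
lemma le_convexEnvelope_endpoint {f : ℝ → ℝ} {m : ℝ} (hm : ∀ v ∈ Icc (0 : ℝ) 1, m ≤ f v)
    (hm0 : m ≤ 0) (h0 : 0 ≤ f 0) (h1 : 0 ≤ f 1) {e : ℝ} (he : e = 0 ∨ e = 1) :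
    0 ≤ convexEnvelope f e := by
  have hem : e ∈ Icc (0 : ℝ) 1 := by rcases he with rfl | rfl <;> simp
  let ψ : ℝ → ℝ := fun u => if u = 0 ∨ u = 1 then 0 else m
  have hψm : ∀ u, m ≤ ψ u := fun u => by
    simp only [ψ]; split_ifs <;> linarith
  have hψ0 : ∀ u, ψ u ≤ 0 := fun u => by
    simp only [ψ]; split_ifs <;> linarith
  have hconv : ConvexOn ℝ (Icc 0 1) ψ := by
    refine ⟨convex_Icc 0 1, fun x hx y hy a b ha hb hab => ?_⟩
    simp only [smul_eq_mul]
    have hle : m ≤ a * ψ x + b * ψ y := by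
      have h3 := mul_le_mul_of_nonneg_left (hψm x) ha
      have h4 := mul_le_mul_of_nonneg_left (hψm y) hb
      have : (a + b) * m = m := by rw [hab, one_mul]
      linarith
    rcases ha.eq_or_lt with rfl | ha'
    · have : b = 1 := by linarith
      simp [this]
    rcases hb.eq_or_lt with rfl | hb'
    · have : a = 1 := by linarith
      simp [this]
    by_cases h : a * x + b * y = 0 ∨ a * x + b * y = 1
    · -- the endpoints are extreme points of the interval
      have hxy : (x = 0 ∧ y = 0) ∨ (x = 1 ∧ y = 1) := by
        rcases h with h | h
        · left
          have h5 := mul_nonneg ha hx.1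
          have h6 := mul_nonneg hb hy.1
          constructor
          · rcases mul_eq_zero.1 (by linarith : a * x = 0) with h | h
            · exact absurd h ha'.ne'
            · exact h
          · rcases mul_eq_zero.1 (by linarith : b * y = 0) with h | h
            · exact absurd h hb'.ne'
            · exact h
        · right
          have h5 := mul_nonneg ha (sub_nonneg.2 hx.2)
          have h6 := mul_nonneg hb (sub_nonneg.2 hy.2)
          constructor
          · rcases mul_eq_zero.1 (by linarith : a * (1 - x) = 0) with h | h
            · exact absurd h ha'.ne'
            · linarith
          · rcases mul_eq_zero.1 (by linarith : b * (1 - y) = 0) with h | h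
            · exact absurd h hb'.ne'
            · linarith
      rcases hxy with ⟨rfl, rfl⟩ | ⟨rfl, rfl⟩ <;> simp [ψ, hab]
    · have : ψ (a * x + b * y) = m := if_neg h
      rw [this]
      exact hle
  have hψf : ∀ v ∈ Icc (0 : ℝ) 1, ψ v ≤ f v := by
    intro v hv
    by_cases h : v = 0 ∨ v = 1
    · rcases h with rfl | rfl
      · exact (hψ0 0).trans h0
      · exact (hψ0 1).trans h1
    · have : ψ v = m := if_neg h
      rw [this]
      exact hm v hv
  have : ψ e = 0 := if_pos he
  rw [← this]
  refine le_csSup ⟨f e, ?_⟩ ⟨ψ, hconv, hψf, rfl⟩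
  rintro _ ⟨h, -, hle, rfl⟩
  exact hle e hem

/-- Integration by parts against a Stieltjes measure, by Fubini's theorem on the triangle
`s < v ≤ a ≤ t`. -/
lemma integral_stieltjes_primitive (f : StieltjesFunction ℝ) {k : ℝ → ℝ} (hk : Measurable k)
    {C : ℝ} (hC : ∀ a, |k a| ≤ C) {s t : ℝ} (hst : s ≤ t) :
    ∫ v in Ioc s t, (∫ a in v..t, k a) ∂f.measure = ∫ a in s..t, k a * (f a - f s) := by
  have hfin : IsFiniteMeasure (f.measure.restrict (Ioc s t)) :=
    ⟨by rw [Measure.restrict_apply_univ, f.measure_Ioc]; exact ENNReal.ofReal_lt_top⟩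
  let F : ℝ → ℝ → ℝ := fun v a => if v ≤ a then k a else 0
  have hFm : Measurable (Function.uncurry F) :=
    Measurable.ite (measurableSet_le measurable_fst measurable_snd) (hk.comp measurable_snd)
      measurable_const
  have hFi : Integrable (Function.uncurry F)
      ((f.measure.restrict (Ioc s t)).prod (volume.restrict (Ioc s t))) := by
    refine Integrable.of_bound hFm.aestronglyMeasurable C (Eventually.of_forall fun p => ?_)
    simp only [Function.uncurry, F, Real.norm_eq_abs]
    split_ifs
    · exact hC _
    · simpa using (abs_nonneg _).trans (hC 0)
  have hswap := integral_integral_swap hFi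
  have hL : ∫ v in Ioc s t, (∫ a in v..t, k a) ∂f.measure =
      ∫ v in Ioc s t, (∫ a in Ioc s t, F v a) ∂f.measure := by
    refine setIntegral_congr_fun measurableSet_Ioc fun v hv => ?_
    rw [intervalIntegral.integral_of_le hv.2, ← integral_Icc_eq_integral_Ioc]
    have : F v = (Ici v).indicator k := by
      funext a
      simp only [F, indicator, mem_Ici]
    rw [this, setIntegral_indicator measurableSet_Ici]
    congr 2
    ext a
    simp only [mem_Icc, mem_inter_iff, mem_Ioc, mem_Ici]
    constructor
    · rintro ⟨h1, h2⟩; exact ⟨⟨hv.1.trans_le h1, h2⟩, h1⟩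
    · rintro ⟨⟨-, h2⟩, h1⟩; exact ⟨h1, h2⟩
  have hR : ∫ a in s..t, k a * (f a - f s) =
      ∫ a in Ioc s t, (∫ v in Ioc s t, F v a ∂f.measure) := by
    rw [intervalIntegral.integral_of_le hst]
    refine setIntegral_congr_fun measurableSet_Ioc fun a ha => ?_
    have : (fun v => F v a) = (Iic a).indicator fun _ => k a := by
      funext v
      simp only [F, indicator, mem_Iic]
    have h2 : Ioc s t ∩ Iic a = Ioc s a := by
      rw [Ioc_inter_Iic, min_eq_right ha.2]
    rw [this, setIntegral_indicator measurableSet_Iic, h2, setIntegral_const, measureReal_def,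
      f.measure_Ioc, ENNReal.toReal_ofReal (sub_nonneg.2 (f.mono ha.1.le)), smul_eq_mul, mul_comm]
  rw [hL, hR, hswap]

/-- The Green function of `-d²/dv²` on `[0,1]` with zero boundary values. -/
def greenKernel (u v : ℝ) : ℝ := min u v - u * v

lemma greenKernel_eq_min (u v : ℝ) : greenKernel u v = min (u * (1 - v)) (v * (1 - u)) := by
  rw [greenKernel, ← min_sub_sub_right]
  congr 1 <;> ring

lemma greenKernel_nonneg {u v : ℝ} (hu0 : 0 ≤ u) (hu1 : u ≤ 1) (hv0 : 0 ≤ v) (hv1 : v ≤ 1) :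
    0 ≤ greenKernel u v := by
  rw [greenKernel_eq_min]
  exact le_min (mul_nonneg hu0 (by linarith)) (mul_nonneg hv0 (by linarith))

lemma continuous_greenKernel : Continuous fun p : ℝ × ℝ => greenKernel p.1 p.2 := by
  unfold greenKernel; fun_prop

/-- The derivative of `greenKernel u v` in `v`. -/
def greenSlope (u v : ℝ) : ℝ := (if v ≤ u then 1 else 0) - u

lemma integral_greenSlope (u : ℝ) {v t : ℝ} (hvt : v ≤ t) :
    ∫ a in v..t, greenSlope u a = greenKernel u t - greenKernel u v := by
  have h1 : IntervalIntegrable (fun a => if a ≤ u then (1 : ℝ) else 0) volume v t :=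
    AntitoneOn.intervalIntegrable fun x _ y _ hxy => by
      split_ifs <;> linarith
  have h2 : ∫ a in v..t, (if a ≤ u then (1 : ℝ) else 0) = min t u - min v u := by
    have : (fun a => if a ≤ u then (1 : ℝ) else 0) = (Iic u).indicator fun _ => 1 := by
      funext a; simp only [indicator, mem_Iic]
    rw [intervalIntegral.integral_of_le hvt, this, setIntegral_indicator measurableSet_Iic,
      Ioc_inter_Iic, setIntegral_const, Real.volume_real_Ioc, smul_eq_mul, mul_one]
    rcases le_total v u with h | h
    · rw [max_eq_left (sub_nonneg.2 (le_min hvt h)), min_eq_left h]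
    · rw [min_eq_right (h.trans hvt), min_eq_right h, max_eq_right (by linarith), sub_self]
  unfold greenSlope
  rw [intervalIntegral.integral_sub h1 intervalIntegrable_const, h2,
    intervalIntegral.integral_const, smul_eq_mul, greenKernel, greenKernel, min_comm u t,
    min_comm u v]
  ring

lemma measurable_greenSlope (u : ℝ) : Measurable (greenSlope u) :=
  (Measurable.ite measurableSet_Iic measurable_const measurable_const).sub measurable_const

lemma abs_greenSlope_le (u a : ℝ) : |greenSlope u a| ≤ 1 + |u| := by
  unfold greenSlope
  refine (abs_sub _ _).trans (add_le_add ?_ le_rfl)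
  split_ifs <;> simp

lemma intervalIntegrable_greenSlope_mul (u : ℝ) {f : ℝ → ℝ} {s t : ℝ}
    (hf : MonotoneOn f (uIcc s t)) :
    IntervalIntegrable (fun a => greenSlope u a * f a) volume s t := by
  have h := hf.intervalIntegrable (μ := volume)
  rw [intervalIntegrable_iff] at h ⊢
  exact h.bdd_mul (c := 1 + |u|) (measurable_greenSlope u).aestronglyMeasurable
    (Eventually.of_forall fun a => abs_greenSlope_le u a)

lemma integral_greenKernel (f : StieltjesFunction ℝ) (u : ℝ) {s t : ℝ} (hst : s ≤ t) :
    ∫ v in Ioc s t, greenKernel u v ∂f.measure =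
      greenKernel u t * f t - greenKernel u s * f s - ∫ a in s..t, greenSlope u a * f a := by
  have h := integral_stieltjes_primitive f (measurable_greenSlope u) (abs_greenSlope_le u) hst
  have hcont : Continuous (greenKernel u) := by
    unfold greenKernel; fun_prop
  have hL : ∫ v in Ioc s t, (∫ a in v..t, greenSlope u a) ∂f.measure =
      greenKernel u t * (f t - f s) - ∫ v in Ioc s t, greenKernel u v ∂f.measure := by
    have hI : IntegrableOn (greenKernel u) (Ioc s t) f.measure :=
      (hcont.integrableOn_Icc (a := s) (b := t)).mono_set Ioc_subset_Icc_self
    have hfin : f.measure (Ioc s t) ≠ ⊤ := by rw [f.measure_Ioc]; exact ENNReal.ofReal_ne_top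
    have hI0 : IntegrableOn (fun _ => greenKernel u t) (Ioc s t) f.measure :=
      integrableOn_const hfin (by finiteness)
    rw [setIntegral_congr_fun measurableSet_Ioc (g := fun v => greenKernel u t - greenKernel u v)
      fun v hv => integral_greenSlope u hv.2, integral_sub hI0 hI,
      setIntegral_const, measureReal_def, f.measure_Ioc,
      ENNReal.toReal_ofReal (sub_nonneg.2 (f.mono hst)), smul_eq_mul, mul_comm]
  have hR : ∫ a in s..t, greenSlope u a * (f a - f s) =
      (∫ a in s..t, greenSlope u a * f a) - (greenKernel u t - greenKernel u s) * f s := by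
    rw [← integral_greenSlope u hst, ← intervalIntegral.integral_mul_const,
      ← intervalIntegral.integral_sub
        (intervalIntegrable_greenSlope_mul u (f.mono.monotoneOn _))
        (intervalIntegrable_greenSlope_mul u (monotoneOn_const))]
    simp only [mul_sub]
  rw [hL, hR] at h
  linarith

section ConvexFunction

variable {h : ℝ → ℝ}

lemma rightDeriv_le_slope_of_convexOn (hh : ConvexOn ℝ (Icc 0 1) h) {x y : ℝ}
    (hx : x ∈ Ioo (0 : ℝ) 1)
    (hy : y ≤ 1) (hxy : x < y) : rightDeriv h x ≤ (h y - h x) / (y - x) := by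
  have := hh.rightDeriv_le_slope_of_mem_interior (by rwa [interior_Icc])
    (⟨hx.1.le.trans hxy.le, hy⟩ : y ∈ Icc (0 : ℝ) 1) hxy
  rwa [slope_def_field] at this

lemma slope_le_rightDeriv_of_convexOn (hh : ConvexOn ℝ (Icc 0 1) h) {x y : ℝ} (hx : 0 ≤ x)
    (hy : y ∈ Ioo (0 : ℝ) 1) (hxy : x < y) : (h y - h x) / (y - x) ≤ rightDeriv h y := by
  have hyi : y ∈ interior (Icc (0 : ℝ) 1) := by rwa [interior_Icc]
  have h1 := hh.slope_le_leftDeriv_of_mem_interior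
    (⟨hx, hxy.le.trans hy.2.le⟩ : x ∈ Icc (0 : ℝ) 1) hyi hxy
  have h2 := hh.leftDeriv_le_rightDeriv_of_mem_interior hyi
  rw [slope_def_field] at h1
  exact h1.trans h2

lemma monotoneOn_rightDeriv_Ioo (hh : ConvexOn ℝ (Icc 0 1) h) :
    MonotoneOn (rightDeriv h) (Ioo 0 1) := by
  have := hh.monotoneOn_rightDeriv
  rwa [interior_Icc] at this

lemma tendsto_rightDeriv (hh : ConvexOn ℝ (Icc 0 1) h) {x : ℝ} (hx : x ∈ Ioo (0 : ℝ) 1) :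
    Tendsto (rightDeriv h) (𝓝[>] x) (𝓝 (rightDeriv h x)) := by
  have hxi : x ∈ interior (Icc (0 : ℝ) 1) := by rwa [interior_Icc]
  have hev : ∀ᶠ y in 𝓝[>] x, y ∈ Ioo x 1 := Ioo_mem_nhdsGT hx.2
  refine tendsto_order.2 ⟨fun a ha => ?_, fun a ha => ?_⟩
  · filter_upwards [hev] with y hy
    exact ha.trans_le (monotoneOn_rightDeriv_Ioo hh hx ⟨hx.1.trans hy.1, hy.2⟩ hy.1.le)
  · -- a secant to the right of `x` has slope less than `a`, and so have the nearby secants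
    have hd : Tendsto (slope h x) (𝓝[>] x) (𝓝 (rightDeriv h x)) :=
      (hasDerivWithinAt_iff_tendsto_slope' self_notMem_Ioi).1
        (hh.hasDerivWithinAt_rightDeriv_of_mem_interior hxi)
    obtain ⟨y, hy1, hy2⟩ := (((tendsto_order.1 hd).2 a ha).and hev).exists
    rw [slope_def_field] at hy1
    have hc : ContinuousAt h x :=
      (hh.continuousOn_interior.continuousAt (isOpen_interior.mem_nhds hxi))
    have hc2 : ContinuousAt (fun z => (h y - h z) / (y - z)) x :=
      (continuousAt_const.sub hc).div (continuousAt_const.sub continuousAt_id)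
        (sub_pos.2 hy2.1).ne'
    have hlt : ∀ᶠ z in 𝓝[>] x, (h y - h z) / (y - z) < a :=
      ((tendsto_order.1 hc2).2 a hy1).filter_mono nhdsWithin_le_nhds
    filter_upwards [hlt, Ioo_mem_nhdsGT hy2.1] with z hz hzy
    exact (rightDeriv_le_slope_of_convexOn hh ⟨hx.1.trans hzy.1, hzy.2.trans hy2.2⟩ hy2.2.le
      hzy.2).trans_lt hz

/-- On `[s,t]` the right limits taken in the definition of `stieltjesOn` change nothing, since the
right derivative of a convex function is right-continuous. -/
lemma exists_stieltjesOn_eq (hh : ConvexOn ℝ (Icc 0 1) h) {s t : ℝ} (hs : 0 < s) (hst : s ≤ t)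
    (ht : t < 1) : ∃ f : StieltjesFunction ℝ, (∀ a ∈ Icc s t, f a = rightDeriv h a) ∧
      stieltjesOn (rightDeriv h) s t = f.measure.restrict (Ioc s t) := by
  have hm : MonotoneOn (rightDeriv h) (Icc s t) := (monotoneOn_rightDeriv_Ioo hh).mono
    fun x hx => ⟨hs.trans_le hx.1, hx.2.trans_lt ht⟩
  refine ⟨(monotone_clamp hst hm).stieltjesFunction, fun a ha => ?_, dif_pos ⟨hst, hm⟩⟩
  rw [Monotone.stieltjesFunction_eq]
  refine rightLim_eq_of_tendsto ?_
  rcases ha.2.eq_or_lt with rfl | hat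
  · refine tendsto_const_nhds.congr' ?_
    filter_upwards [self_mem_nhdsWithin] with y hy
    rw [min_eq_right (le_of_lt hy), max_eq_right hst]
  · refine (tendsto_rightDeriv hh ⟨hs.trans_le ha.1, ha.2.trans_lt ht⟩).congr' ?_
    filter_upwards [Ioo_mem_nhdsGT hat] with y hy
    rw [min_eq_left hy.2.le, max_eq_right (ha.1.trans hy.1.le)]

lemma integral_rightDeriv (hh : ConvexOn ℝ (Icc 0 1) h) {s t : ℝ} (hs : 0 < s) (hst : s ≤ t)
    (ht : t < 1) : ∫ a in s..t, rightDeriv h a = h t - h s := by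
  have hsub : ∀ x ∈ Icc s t, x ∈ interior (Icc (0 : ℝ) 1) := fun x hx => by
    rw [interior_Icc]; exact ⟨hs.trans_le hx.1, hx.2.trans_lt ht⟩
  refine intervalIntegral.integral_eq_sub_of_hasDeriv_right_of_le hst
    (hh.continuousOn_interior.mono hsub)
    (fun x hx => hh.hasDerivWithinAt_rightDeriv_of_mem_interior (hsub x (Ioo_subset_Icc_self hx))) ?_
  refine MonotoneOn.intervalIntegrable ?_
  rw [uIcc_of_le hst]
  exact hh.monotoneOn_rightDeriv.mono hsub

/-- The truncation to `(s,t]` of the Green potential of the measure `dh'`. -/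
def greenPotential (h : ℝ → ℝ) (s t u : ℝ) : ENNReal :=
  ∫⁻ v, ENNReal.ofReal (greenKernel u v) ∂stieltjesOn (rightDeriv h) s t

lemma greenPotential_eq (hh : ConvexOn ℝ (Icc 0 1) h) {s t u : ℝ} (hs : 0 < s) (hst : s ≤ t)
    (ht : t < 1) (hu : u ∈ Icc (0 : ℝ) 1) :
    0 ≤ greenKernel u t * rightDeriv h t - greenKernel u s * rightDeriv h s -
        ∫ a in s..t, greenSlope u a * rightDeriv h a ∧
    greenPotential h s t u = ENNReal.ofReal
      (greenKernel u t * rightDeriv h t - greenKernel u s * rightDeriv h s -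
        ∫ a in s..t, greenSlope u a * rightDeriv h a) := by
  obtain ⟨f, hf, hm⟩ := exists_stieltjesOn_eq hh hs hst ht
  have hint := integral_greenKernel f u hst
  rw [hf t ⟨hst, le_rfl⟩, hf s ⟨le_rfl, hst⟩, intervalIntegral.integral_congr
    (g := fun a => greenSlope u a * rightDeriv h a) (fun a ha => by
      rw [uIcc_of_le hst] at ha
      simp only [hf a ha])] at hint
  have hcont : Continuous (greenKernel u) := by
    unfold greenKernel; fun_prop
  have hI : IntegrableOn (greenKernel u) (Ioc s t) f.measure :=
    (hcont.integrableOn_Icc (a := s) (b := t)).mono_set Ioc_subset_Icc_self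
  have hnn : 0 ≤ᵐ[f.measure.restrict (Ioc s t)] greenKernel u := by
    filter_upwards [ae_restrict_mem measurableSet_Ioc] with v hv
    exact greenKernel_nonneg hu.1 hu.2 (hs.le.trans hv.1.le) (hv.2.trans ht.le)
  rw [greenPotential, hm, ← hint, ofReal_integral_eq_lintegral_ofReal hI hnn]
  exact ⟨integral_nonneg_of_ae hnn, rfl⟩

lemma greenPotential_add (hh : ConvexOn ℝ (Icc 0 1) h) {s m t u : ℝ} (hs : 0 < s) (hsm : s ≤ m)
    (hmt : m ≤ t) (ht : t < 1) (hsu : s ≤ u) (hut : u ≤ t) :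
    greenPotential h s m u + greenPotential h m t u = ENNReal.ofReal
      (-h u + (1 - u) * (h s - s * rightDeriv h s) + u * (h t + (1 - t) * rightDeriv h t)) := by
  have hu : u ∈ Icc (0 : ℝ) 1 := ⟨hs.le.trans hsu, hut.trans ht.le⟩
  obtain ⟨h1, e1⟩ := greenPotential_eq hh hs hsm (hmt.trans_lt ht) hu
  obtain ⟨h2, e2⟩ := greenPotential_eq hh (hs.trans_le hsm) hmt ht hu
  have hmono : ∀ x ∈ Icc s t, ∀ y ∈ Icc s t, MonotoneOn (rightDeriv h) (uIcc x y) :=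
    fun x hx y hy => (monotoneOn_rightDeriv_Ioo hh).mono fun z hz =>
      have hz' := uIcc_subset_Icc hx hy hz
      ⟨hs.trans_le hz'.1, hz'.2.trans_lt ht⟩
  have hsI : s ∈ Icc s t := ⟨le_rfl, hsm.trans hmt⟩
  have hmI : m ∈ Icc s t := ⟨hsm, hmt⟩
  have htI : t ∈ Icc s t := ⟨hsm.trans hmt, le_rfl⟩
  have huI : u ∈ Icc s t := ⟨hsu, hut⟩
  have hadd := intervalIntegral.integral_add_adjacent_intervals
    (intervalIntegrable_greenSlope_mul u (hmono s hsI m hmI))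
    (intervalIntegrable_greenSlope_mul u (hmono m hmI t htI))
  have hadd' := intervalIntegral.integral_add_adjacent_intervals
    (intervalIntegrable_greenSlope_mul u (hmono s hsI u huI))
    (intervalIntegrable_greenSlope_mul u (hmono u huI t htI))
  have hl : ∫ a in s..u, greenSlope u a * rightDeriv h a = (1 - u) * (h u - h s) := by
    rw [← integral_rightDeriv hh hs hsu (hut.trans_lt ht), ← intervalIntegral.integral_const_mul]
    refine intervalIntegral.integral_congr fun a ha => ?_
    rw [uIcc_of_le hsu] at ha
    simp only [greenSlope, if_pos ha.2]
  have hr : ∫ a in u..t, greenSlope u a * rightDeriv h a = -u * (h t - h u) := by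
    rw [← integral_rightDeriv hh (hs.trans_le hsu) hut ht, ← intervalIntegral.integral_const_mul,
      intervalIntegral.integral_of_le hut, intervalIntegral.integral_of_le hut]
    refine setIntegral_congr_fun measurableSet_Ioc fun a ha => ?_
    simp only [greenSlope, if_neg (not_le.2 ha.1)]
    ring
  have ks : greenKernel u s = s * (1 - u) := by rw [greenKernel, min_eq_right hsu]; ring
  have kt : greenKernel u t = u * (1 - t) := by rw [greenKernel, min_eq_left hut]; ring
  rw [e1, e2, ← ENNReal.ofReal_add h1 h2]
  congr 1
  rw [ks, kt]
  linarith

/-- The value at `0` of the tangent at `s` tends to `0` with `s`: it lies between `0` and a quantity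
computed from the secant over `[s, 2 * s]`. -/
lemma tendsto_boundary_zero (hh : ConvexOn ℝ (Icc 0 1) h) (hc : ContinuousOn h (Icc 0 1))
    (h0 : h 0 = 0) : Tendsto (fun s => h s - s * rightDeriv h s) (𝓝[>] 0) (𝓝 0) := by
  have hc0 : Tendsto h (𝓝[>] 0) (𝓝 0) := by
    have := (hc 0 (by simp)).mono_left 
      (nhdsWithin_mono 0 (Ioc_subset_Icc_self : Ioc (0 : ℝ) 1 ⊆ Icc 0 1))
    rwa [h0, nhdsWithin_Ioc_eq_nhdsGT zero_lt_one] at this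
  have hdbl : Tendsto (fun s : ℝ => 2 * s) (𝓝[>] 0) (𝓝[>] 0) := by
    refine tendsto_nhdsWithin_iff.2 ⟨?_, ?_⟩
    · have : Tendsto (fun s : ℝ => 2 * s) (𝓝 0) (𝓝 (2 * 0)) :=
        (continuous_const.mul continuous_id).tendsto 0
      rw [mul_zero] at this
      exact this.mono_left nhdsWithin_le_nhds
    · filter_upwards [self_mem_nhdsWithin] with s hs
      rw [mem_Ioi] at hs ⊢
      linarith
  have hlow : Tendsto (fun s => h s - (h (2 * s) - h s)) (𝓝[>] 0) (𝓝 0) := by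
    simpa using hc0.sub ((hc0.comp hdbl).sub hc0)
  refine tendsto_of_tendsto_of_tendsto_of_le_of_le' hlow tendsto_const_nhds ?_ ?_
  · filter_upwards [Ioo_mem_nhdsGT (by norm_num : (0 : ℝ) < 1 / 2)] with s hs
    have := rightDeriv_le_slope_of_convexOn hh (x := s) (y := 2 * s)
      ⟨hs.1, by linarith [hs.2]⟩ (by linarith [hs.2]) (by linarith [hs.1])
    rw [le_div_iff₀ (by linarith [hs.1])] at this
    linarith
  · filter_upwards [Ioo_mem_nhdsGT (by norm_num : (0 : ℝ) < 1)] with s hs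
    have := slope_le_rightDeriv_of_convexOn hh le_rfl hs hs.1
    rw [h0, sub_zero, sub_zero, div_le_iff₀ hs.1] at this
    linarith

lemma tendsto_boundary_one (hh : ConvexOn ℝ (Icc 0 1) h) (hc : ContinuousOn h (Icc 0 1))
    (h1 : h 1 = 0) : Tendsto (fun t => h t + (1 - t) * rightDeriv h t) (𝓝[<] 1) (𝓝 0) := by
  have hc1 : Tendsto h (𝓝[<] 1) (𝓝 0) := by
    have := (hc 1 (by simp)).mono_left 
      (nhdsWithin_mono 1 (Ico_subset_Icc_self : Ico (0 : ℝ) 1 ⊆ Icc 0 1))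
    rwa [h1, nhdsWithin_Ico_eq_nhdsLT zero_lt_one] at this
  have hdbl : Tendsto (fun t : ℝ => 2 * t - 1) (𝓝[<] 1) (𝓝[<] 1) := by
    refine tendsto_nhdsWithin_iff.2 ⟨?_, ?_⟩
    · have : Tendsto (fun t : ℝ => 2 * t - 1) (𝓝 1) (𝓝 (2 * 1 - 1)) :=
        ((continuous_const.mul continuous_id).sub continuous_const).tendsto 1
      rw [show (2 : ℝ) * 1 - 1 = 1 by norm_num] at this
      exact this.mono_left nhdsWithin_le_nhds
    · filter_upwards [self_mem_nhdsWithin] with t ht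
      rw [mem_Iio] at ht ⊢
      linarith
  have hlow : Tendsto (fun t => h t + (h t - h (2 * t - 1))) (𝓝[<] 1) (𝓝 0) := by
    simpa using hc1.add (hc1.sub (hc1.comp hdbl))
  refine tendsto_of_tendsto_of_tendsto_of_le_of_le' hlow tendsto_const_nhds ?_ ?_
  · filter_upwards [Ioo_mem_nhdsLT (by norm_num : (1 / 2 : ℝ) < 1)] with t ht
    have := slope_le_rightDeriv_of_convexOn hh (x := 2 * t - 1) (y := t)
      (by linarith [ht.1]) ⟨by linarith [ht.1], ht.2⟩ (by linarith [ht.2])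
    rw [div_le_iff₀ (by linarith [ht.2])] at this
    linarith
  · filter_upwards [Ioo_mem_nhdsLT (by norm_num : (0 : ℝ) < 1)] with t ht
    have := rightDeriv_le_slope_of_convexOn hh ht le_rfl ht.2
    rw [h1, le_div_iff₀ (by linarith [ht.2])] at this
    linarith

/-- The Green representation `-h u = ∫ greenKernel u v dh'(v)` of a continuous convex function on
`[0,1]` that vanishes at both endpoints. -/
lemma tendsto_greenPotential (hh : ConvexOn ℝ (Icc 0 1) h) (hc : ContinuousOn h (Icc 0 1))
    (h0 : h 0 = 0) (h1 : h 1 = 0) {s t : ℕ → ℝ} {m u : ℝ} (hs : Tendsto s atTop (𝓝[>] 0))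
    (ht : Tendsto t atTop (𝓝[<] 1)) (hm : m ∈ Ioo (0 : ℝ) 1) (hu : u ∈ Ioo (0 : ℝ) 1) :
    Tendsto (fun n => greenPotential h (s n) m u + greenPotential h m (t n) u) atTop
      (𝓝 (ENNReal.ofReal (-h u))) := by
  have hlim : Tendsto (fun n => -h u + (1 - u) * (h (s n) - s n * rightDeriv h (s n)) +
      u * (h (t n) + (1 - t n) * rightDeriv h (t n))) atTop (𝓝 (-h u)) := by
    have := (tendsto_const_nhds (x := -h u)).add
      (((tendsto_boundary_zero hh hc h0).comp hs).const_mul (1 - u))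
    have := this.add (((tendsto_boundary_one hh hc h1).comp ht).const_mul u)
    simpa using this
  refine (ENNReal.tendsto_ofReal hlim).congr' ?_
  filter_upwards [hs.eventually (Ioo_mem_nhdsGT (lt_min hm.1 hu.1)),
    ht.eventually (Ioo_mem_nhdsLT (max_lt hm.2 hu.2))] with n hsn htn
  exact (greenPotential_add hh hsn.1 (hsn.2.le.trans (min_le_left _ _))
    ((le_max_left _ _).trans htn.1.le) htn.2 (hsn.2.le.trans (min_le_right _ _))
    ((le_max_right _ _).trans htn.1.le)).symm

end ConvexFunction

/-! ### The upper bound -/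

variable {Ω : Type*} [MeasurableSpace Ω]

lemma lintegral_measure_le_eq (P : Measure Ω) [SFinite P] {X : Ω → ℝ} (hX : Measurable X) (t : ℝ) :
    ∫⁻ x in Iio t, P {ω | X ω ≤ x} = ∫⁻ ω, ENNReal.ofReal (t - X ω) ∂P := by
  have hS : MeasurableSet {p : ℝ × Ω | X p.2 ≤ p.1} :=
    measurableSet_le (hX.comp measurable_snd) measurable_fst
  have h1 := Measure.prod_apply (μ := volume.restrict (Iio t)) (ν := P) hS
  have h2 := Measure.prod_apply_symm (μ := volume.restrict (Iio t)) (ν := P) hS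
  rw [h1] at h2
  refine Eq.trans h2 (lintegral_congr fun ω => ?_)
  have hset : (fun x => (x, ω)) ⁻¹' {p : ℝ × Ω | X p.2 ≤ p.1} = Ici (X ω) := rfl
  rw [hset, Measure.restrict_apply measurableSet_Ici, Ici_inter_Iio, Real.volume_Ico]

lemma lintegral_measure_lt_eq (P : Measure Ω) [SFinite P] {X : Ω → ℝ} (hX : Measurable X) (t : ℝ) :
    ∫⁻ x in Ici t, P {ω | x < X ω} = ∫⁻ ω, ENNReal.ofReal (X ω - t) ∂P := by
  have hS : MeasurableSet {p : ℝ × Ω | p.1 < X p.2} :=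
    measurableSet_lt measurable_fst (hX.comp measurable_snd)
  have h1 := Measure.prod_apply (μ := volume.restrict (Ici t)) (ν := P) hS
  have h2 := Measure.prod_apply_symm (μ := volume.restrict (Ici t)) (ν := P) hS
  rw [h1] at h2
  refine Eq.trans h2 (lintegral_congr fun ω => ?_)
  have hset : (fun x => (x, ω)) ⁻¹' {p : ℝ × Ω | p.1 < X p.2} = Iio (X ω) := rfl
  rw [hset, Measure.restrict_apply measurableSet_Iio, inter_comm, Ici_inter_Iio, Real.volume_Ico]

lemma setLIntegral_eq_of_eq_zero_on_sdiff {f : ℝ → ENNReal} {s t : Set ℝ} (hs : MeasurableSet s)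
    (ht : MeasurableSet t) (hst : s ⊆ t) (h : ∀ x ∈ t \ s, f x = 0) :
    ∫⁻ x in t, f x = ∫⁻ x in s, f x := by
  rw [← inter_eq_left.2 hst, ← setLIntegral_indicator hs]
  refine setLIntegral_congr_fun ht fun x hx => ?_
  by_cases hxs : x ∈ s
  · rw [indicator_of_mem hxs]
  · rw [indicator_of_notMem hxs, h x ⟨hx, hxs⟩]

section UpperBound

variable {P : Measure Ω} [IsProbabilityMeasure P] {X : Ω → ℝ}

lemma intervalIntegrable_quantile (hX : Measurable X) (h2 : MemLp X 2 P) :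
    IntervalIntegrable (quantile P X) volume 0 1 ∧
      IntervalIntegrable (fun u => quantile P X u ^ 2) volume 0 1 := by
  have hid := identDistrib_quantile (P := P) hX
  constructor
  · rw [intervalIntegrable_iff_integrableOn_Ioo_of_le zero_le_one]
    exact hid.integrable_iff.2 (h2.integrable (by norm_num))
  · rw [intervalIntegrable_iff_integrableOn_Ioo_of_le zero_le_one]
    exact (hid.sq.integrable_iff).2 h2.integrable_sq

lemma integral_quantile (hX : Measurable X) :
    ∫ u in (0 : ℝ)..1, quantile P X u = ∫ ω, X ω ∂P := by
  rw [intervalIntegral.integral_of_le zero_le_one, integral_Ioc_eq_integral_Ioo]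
  exact (identDistrib_quantile hX).integral_eq

lemma integral_quantile_sq (hX : Measurable X) :
    ∫ u in (0 : ℝ)..1, quantile P X u ^ 2 = ∫ ω, X ω ^ 2 ∂P := by
  rw [intervalIntegral.integral_of_le zero_le_one, integral_Ioc_eq_integral_Ioo]
  exact (identDistrib_quantile hX).sq.integral_eq

lemma tailGap_quantile_le {μ σ : ℝ} (hσ : 0 ≤ σ) (hX : X ∈ unimodalClass P μ σ) {v : ℝ}
    (hv : v ∈ Ioo (0 : ℝ) 1) :
    tailGap v (quantile P X) ≤ σ / 3 * unimodalBound v := by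
  obtain ⟨hXm, hX2, -, hvar, x₀, hconv, hconc⟩ := hX
  obtain ⟨hI, hI2⟩ := intervalIntegrable_quantile hXm hX2
  have h := tailGap_le hv.1 hv.2 (c := distFun P X x₀) measureReal_nonneg measureReal_le_one
    (convexOn_quantile hXm hconv hconc) (concaveOn_quantile hXm hconv) hI hI2
  rw [integral_quantile hXm, integral_quantile_sq hXm] at h
  rw [variance_eq_sub hX2] at hvar
  simp only [Pi.pow_apply] at hvar
  rw [hvar, Real.sqrt_sq hσ] at h
  linarith

/-- Splitting the integral at the quantile `t = q v`, the kernel is bounded by `(1 - v) * F x` on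
the left and by `v * (1 - F x)` on the right of `t`; these integrate to `(1 - v) * E (t - X)⁺` and
`v * E (X - t)⁺`, whose sum is `tailGap v q`. -/
lemma lintegral_greenKernel_distFun_le (hX : Measurable X) (h2 : MemLp X 2 P) {v : ℝ}
    (hv : v ∈ Ioo (0 : ℝ) 1) :
    ∫⁻ x, ENNReal.ofReal (greenKernel (distFun P X x) v) ≤
      ENNReal.ofReal (tailGap v (quantile P X)) := by
  obtain ⟨hI, -⟩ := intervalIntegrable_quantile hX h2
  obtain ⟨t, ht⟩ : ∃ t, t = quantile P X v := ⟨_, rfl⟩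
  have hid := identDistrib_quantile (P := P) hX
  have hv01 : v ∈ uIcc (0 : ℝ) 1 := by rw [uIcc_of_le zero_le_one]; exact ⟨hv.1.le, hv.2.le⟩
  have hI0 : IntervalIntegrable (quantile P X) volume 0 v :=
    hI.mono_set (uIcc_subset_uIcc left_mem_uIcc hv01)
  have hI1 : IntervalIntegrable (quantile P X) volume v 1 :=
    hI.mono_set (uIcc_subset_uIcc hv01 right_mem_uIcc)
  have hq0 : ∀ u ∈ Ioo (0 : ℝ) v, quantile P X u ≤ t := fun u hu => by
    rw [ht]; exact monotoneOn_quantile hX ⟨hu.1, hu.2.trans hv.2⟩ hv hu.2.le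
  have hq1 : ∀ u ∈ Ioo v (1 : ℝ), t ≤ quantile P X u := fun u hu => by
    rw [ht]; exact monotoneOn_quantile hX hv ⟨hv.1.trans hu.1, hu.2⟩ hu.1.le
  -- the part to the left of the `v`-quantile
  have hleft : ∫⁻ x in Iio t, ENNReal.ofReal (greenKernel (distFun P X x) v) ≤
      ENNReal.ofReal ((1 - v) * ∫ u in (0 : ℝ)..v, (t - quantile P X u)) := by
    have e1 : ∫⁻ ω, ENNReal.ofReal (t - X ω) ∂P =
        ∫⁻ u in Ioo (0 : ℝ) 1, ENNReal.ofReal (t - quantile P X u) :=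
      ((hid.comp (u := fun x => ENNReal.ofReal (t - x)) (by fun_prop)).lintegral_eq).symm
    have e2 : ∫⁻ u in Ioo (0 : ℝ) 1, ENNReal.ofReal (t - quantile P X u) =
        ∫⁻ u in Ioo (0 : ℝ) v, ENNReal.ofReal (t - quantile P X u) := by
      refine setLIntegral_eq_of_eq_zero_on_sdiff measurableSet_Ioo measurableSet_Ioo
        (Ioo_subset_Ioo_right hv.2.le) fun u hu => ?_
      have huv : v ≤ u := by
        by_contra h
        exact hu.2 ⟨hu.1.1, not_le.1 h⟩
      refine ENNReal.ofReal_of_nonpos (sub_nonpos.2 ?_)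
      rw [ht]; exact monotoneOn_quantile hX hv hu.1 huv
    have e3 : ∫⁻ u in Ioo (0 : ℝ) v, ENNReal.ofReal (t - quantile P X u) =
        ENNReal.ofReal (∫ u in (0 : ℝ)..v, (t - quantile P X u)) := by
      rw [intervalIntegral.integral_of_le hv.1.le, integral_Ioc_eq_integral_Ioo,
        ofReal_integral_eq_lintegral_ofReal]
      · exact (intervalIntegrable_iff_integrableOn_Ioo_of_le hv.1.le).1
          (intervalIntegrable_const.sub hI0)
      · filter_upwards [ae_restrict_mem measurableSet_Ioo] with u hu
        exact sub_nonneg.2 (hq0 u hu)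
    rw [ENNReal.ofReal_mul (by linarith [hv.2]), ← e3, ← e2, ← e1, ← lintegral_measure_le_eq P hX,
      ← lintegral_const_mul' _ _ ENNReal.ofReal_ne_top]
    refine lintegral_mono fun x => ?_
    rw [← ENNReal.ofReal_toReal (measure_ne_top P {ω | X ω ≤ x}),
      ← ENNReal.ofReal_mul (by linarith [hv.2]), greenKernel_eq_min]
    exact ENNReal.ofReal_le_ofReal ((min_le_left _ _).trans_eq (mul_comm _ _))
  have hright : ∫⁻ x in Ici t, ENNReal.ofReal (greenKernel (distFun P X x) v) ≤
      ENNReal.ofReal (v * ∫ u in v..1, (quantile P X u - t)) := by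
    have e1 : ∫⁻ ω, ENNReal.ofReal (X ω - t) ∂P =
        ∫⁻ u in Ioo (0 : ℝ) 1, ENNReal.ofReal (quantile P X u - t) :=
      ((hid.comp (u := fun x => ENNReal.ofReal (x - t)) (by fun_prop)).lintegral_eq).symm
    have e2 : ∫⁻ u in Ioo (0 : ℝ) 1, ENNReal.ofReal (quantile P X u - t) =
        ∫⁻ u in Ioo v 1, ENNReal.ofReal (quantile P X u - t) := by
      refine setLIntegral_eq_of_eq_zero_on_sdiff measurableSet_Ioo measurableSet_Ioo
        (Ioo_subset_Ioo_left hv.1.le) fun u hu => ?_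
      have huv : u ≤ v := by
        by_contra h
        exact hu.2 ⟨not_le.1 h, hu.1.2⟩
      refine ENNReal.ofReal_of_nonpos (sub_nonpos.2 ?_)
      rw [ht]; exact monotoneOn_quantile hX hu.1 hv huv
    have e3 : ∫⁻ u in Ioo v 1, ENNReal.ofReal (quantile P X u - t) =
        ENNReal.ofReal (∫ u in v..1, (quantile P X u - t)) := by
      rw [intervalIntegral.integral_of_le hv.2.le, integral_Ioc_eq_integral_Ioo,
        ofReal_integral_eq_lintegral_ofReal]
      · exact (intervalIntegrable_iff_integrableOn_Ioo_of_le hv.2.le).1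
          (hI1.sub intervalIntegrable_const)
      · filter_upwards [ae_restrict_mem measurableSet_Ioo] with u hu
        exact sub_nonneg.2 (hq1 u hu)
    rw [ENNReal.ofReal_mul hv.1.le, ← e3, ← e2, ← e1, ← lintegral_measure_lt_eq P hX,
      ← lintegral_const_mul' _ _ ENNReal.ofReal_ne_top]
    refine lintegral_mono fun x => ?_
    rw [← ENNReal.ofReal_toReal (measure_ne_top P {ω | x < X ω}),
      ← ENNReal.ofReal_mul hv.1.le, greenKernel_eq_min]
    have := tailFun_eq P hX x
    rw [tailFun, measureReal_def] at this
    rw [this]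
    exact ENNReal.ofReal_le_ofReal (min_le_right _ _)
  have hA : 0 ≤ ∫ u in (0 : ℝ)..v, (t - quantile P X u) := by
    rw [intervalIntegral.integral_of_le hv.1.le, integral_Ioc_eq_integral_Ioo]
    exact setIntegral_nonneg measurableSet_Ioo fun u hu => sub_nonneg.2 (hq0 u hu)
  have hB : 0 ≤ ∫ u in v..1, (quantile P X u - t) := by
    rw [intervalIntegral.integral_of_le hv.2.le, integral_Ioc_eq_integral_Ioo]
    exact setIntegral_nonneg measurableSet_Ioo fun u hu => sub_nonneg.2 (hq1 u hu)
  rw [← lintegral_add_compl _ (measurableSet_Iio (a := t)), compl_Iio]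
  refine (add_le_add hleft hright).trans ?_
  rw [← ENNReal.ofReal_add (mul_nonneg (by linarith [hv.2]) hA) (mul_nonneg hv.1.le hB)]
  refine ENNReal.ofReal_le_ofReal (le_of_eq ?_)
  rw [intervalIntegral.integral_sub intervalIntegrable_const hI0,
    intervalIntegral.integral_sub hI1 intervalIntegrable_const, intervalIntegral.integral_const,
    intervalIntegral.integral_const, tailGap,
    ← intervalIntegral.integral_add_adjacent_intervals hI0 hI1]
  simp only [smul_eq_mul]
  ring

lemma lintegral_greenPotential_le {h : ℝ → ℝ} (hh : ConvexOn ℝ (Icc 0 1) h) {μ σ : ℝ}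
    (hσ : 0 ≤ σ) (hX : X ∈ unimodalClass P μ σ) {s t : ℝ} (hs : 0 < s) (hst : s ≤ t) (ht : t < 1) :
    ∫⁻ x, greenPotential h s t (distFun P X x) ≤ ENNReal.ofReal (σ / 3) *
      ∫⁻ v, ENNReal.ofReal (unimodalBound v) ∂stieltjesOn (rightDeriv h) s t := by
  obtain ⟨f, -, hm⟩ := exists_stieltjesOn_eq hh hs hst ht
  unfold greenPotential
  rw [hm]
  have hF : Measurable (distFun P X) := (monotone_distFun hX.1).measurable
  have hmeas : Measurable (Function.uncurry fun x v =>
      ENNReal.ofReal (greenKernel (distFun P X x) v)) :=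
    (continuous_greenKernel.measurable.comp
      ((hF.comp measurable_fst).prodMk measurable_snd)).ennreal_ofReal
  rw [lintegral_lintegral_swap hmeas.aemeasurable, ← lintegral_const_mul' _ _ ENNReal.ofReal_ne_top]
  refine setLIntegral_mono' measurableSet_Ioc fun v hv => ?_
  have hv' : v ∈ Ioo (0 : ℝ) 1 := ⟨hs.trans hv.1, hv.2.trans_lt ht⟩
  refine (lintegral_greenKernel_distFun_le hX.1 hX.2.1 hv').trans ?_
  rw [← ENNReal.ofReal_mul (by positivity)]
  exact ENNReal.ofReal_le_ofReal (tailGap_quantile_le hσ hX hv')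

lemma setLIntegral_unimodalBound_left_le {r : ℝ → ℝ} {s : ℝ} (hs : s ∈ Ioo (0 : ℝ) (1 / 2)) :
    ∫⁻ v, ENNReal.ofReal (unimodalBound v) ∂stieltjesOn r s (1 / 2) ≤ thetaLeft r := by
  refine le_trans ?_ (le_iSup₂ (f := fun s (_ : s ∈ Ioo (0 : ℝ) (1 / 2)) =>
    ∫⁻ u, ENNReal.ofReal √(u * (8 - 9 * u)) ∂(stieltjesOn r s (1 / 2))) s hs)
  unfold stieltjesOn
  split_ifs
  · refine setLIntegral_mono' measurableSet_Ioc fun v hv => ?_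
    rw [unimodalBound, if_pos hv.2]
  · simp

lemma setLIntegral_unimodalBound_right_le {r : ℝ → ℝ} {t : ℝ} (ht : t ∈ Ioo (1 / 2 : ℝ) 1) :
    ∫⁻ v, ENNReal.ofReal (unimodalBound v) ∂stieltjesOn r (1 / 2) t ≤ thetaRight r := by
  refine le_trans ?_ (le_iSup₂ (f := fun t (_ : t ∈ Ioo (1 / 2 : ℝ) 1) =>
    ∫⁻ u, ENNReal.ofReal √((9 * u - 1) * (1 - u)) ∂(stieltjesOn r (1 / 2) t)) t ht)
  unfold stieltjesOn
  split_ifs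
  · refine setLIntegral_mono' measurableSet_Ioc fun v hv => ?_
    rw [unimodalBound, if_neg (not_le.2 hv.1)]
  · simp

/-- Fatou's lemma passes from the truncated Green potentials to `-h`. -/
lemma lintegral_neg_convex_distFun_le {h : ℝ → ℝ} (hh : ConvexOn ℝ (Icc 0 1) h)
    (hc : ContinuousOn h (Icc 0 1)) (h0 : h 0 = 0) (h1 : h 1 = 0) {μ σ : ℝ}
    (hσ : 0 ≤ σ) (hX : X ∈ unimodalClass P μ σ) :
    ∫⁻ x, ENNReal.ofReal (-h (distFun P X x)) ≤
      ENNReal.ofReal (σ / 3) * (thetaLeft (rightDeriv h) + thetaRight (rightDeriv h)) := by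
  let s : ℕ → ℝ := fun n => 1 / ((n : ℝ) + 3)
  have hs3 : ∀ n, s n ∈ Ioo (0 : ℝ) (1 / 2) := fun n => by
    have : (0 : ℝ) ≤ n := Nat.cast_nonneg n
    exact ⟨by positivity, one_div_lt_one_div_of_lt (by norm_num) (by linarith)⟩
  have hs0 : Tendsto s atTop (𝓝 0) :=
    (tendsto_const_nhds (x := (1 : ℝ))).div_atTop
      (tendsto_atTop_add_const_right _ _ tendsto_natCast_atTop_atTop)
  have hs : Tendsto s atTop (𝓝[>] 0) :=
    tendsto_nhdsWithin_iff.2 ⟨hs0, Eventually.of_forall fun n => (hs3 n).1⟩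
  have ht : Tendsto (fun n => 1 - s n) atTop (𝓝[<] 1) := by
    refine tendsto_nhdsWithin_iff.2 ⟨by simpa using hs0.const_sub 1,
      Eventually.of_forall fun n => ?_⟩
    rw [mem_Iio]; linarith [(hs3 n).1]
  let G : ℕ → ℝ → ENNReal := fun n u =>
    greenPotential h (s n) (1 / 2) u + greenPotential h (1 / 2) (1 - s n) u
  have hF : Measurable (distFun P X) := (monotone_distFun hX.1).measurable
  have hpot : ∀ a b : ℝ, 0 < a → a ≤ b → b < 1 → Measurable (greenPotential h a b) := by
    intro a b ha hab hb
    obtain ⟨f, -, hm⟩ := exists_stieltjesOn_eq hh ha hab hb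
    unfold greenPotential
    rw [hm]
    exact Measurable.lintegral_prod_right continuous_greenKernel.measurable.ennreal_ofReal
  have hpot1 : ∀ n, Measurable (greenPotential h (s n) (1 / 2)) := fun n =>
    hpot _ _ (hs3 n).1 (hs3 n).2.le (by norm_num)
  have hpot2 : ∀ n, Measurable (greenPotential h (1 / 2) (1 - s n)) := fun n =>
    hpot _ _ (by norm_num) (by linarith [(hs3 n).2]) (by linarith [(hs3 n).1])
  have hpt : ∀ x, ENNReal.ofReal (-h (distFun P X x)) ≤
      liminf (fun n => G n (distFun P X x)) atTop := by
    intro x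
    have hx0 : 0 ≤ distFun P X x := measureReal_nonneg
    have hx1 : distFun P X x ≤ 1 := measureReal_le_one
    rcases hx0.eq_or_lt with hx | hx
    · simp [← hx, h0]
    rcases hx1.eq_or_lt with hx' | hx'
    · simp [hx', h1]
    exact (tendsto_greenPotential hh hc h0 h1 hs ht (by norm_num) ⟨hx, hx'⟩).liminf_eq.ge
  have hbound : ∀ n, ∫⁻ x, G n (distFun P X x) ≤
      ENNReal.ofReal (σ / 3) * (thetaLeft (rightDeriv h) + thetaRight (rightDeriv h)) := by
    intro n
    have hm : Measurable fun x => greenPotential h (s n) (1 / 2) (distFun P X x) :=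
      (hpot1 n).comp hF
    simp only [G]
    rw [lintegral_add_left hm, mul_add]
    refine add_le_add ?_ ?_
    · refine (lintegral_greenPotential_le hh hσ hX (hs3 n).1 (hs3 n).2.le (by norm_num)).trans ?_
      gcongr
      exact setLIntegral_unimodalBound_left_le (hs3 n)
    · refine (lintegral_greenPotential_le hh hσ hX (by norm_num) (by linarith [(hs3 n).2])
        (by linarith [(hs3 n).1])).trans ?_
      gcongr
      exact setLIntegral_unimodalBound_right_le
        ⟨by linarith [(hs3 n).2], by linarith [(hs3 n).1]⟩
  calc ∫⁻ x, ENNReal.ofReal (-h (distFun P X x))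
      ≤ ∫⁻ x, liminf (fun n => G n (distFun P X x)) atTop := lintegral_mono hpt
    _ ≤ liminf (fun n => ∫⁻ x, G n (distFun P X x)) atTop :=
        lintegral_liminf_le fun n => ((hpot1 n).comp hF).add ((hpot2 n).comp hF)
    _ ≤ _ := liminf_le_of_le (by isBoundedDefault)
        fun b hb => by
          obtain ⟨n, hn⟩ := hb.exists
          exact hn.trans (hbound n)

theorem worstCaseEntropy_le {g : ℝ → ℝ} (hg : IsDistortion g) (hg1 : g 1 = 0) (μ : ℝ) {σ : ℝ}
    (hσ : 0 ≤ σ) : worstCaseEntropy g P μ σ ≤ ((σ / 3 : ℝ) : EReal) * Theta g := by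
  refine iSup₂_le fun X hX => ?_
  obtain ⟨hX, -⟩ := hX
  rcases hσ.eq_or_lt with rfl | hσ0
  · have hconst : X =ᵐ[P] fun _ => μ := by
      have hv : variance X P = 0 := by rw [hX.2.2.2.1]; norm_num
      rw [← hX.2.2.1]
      exact ae_eq_integral_of_variance_eq_zero hX.2.1 hv
    obtain ⟨h1, h2⟩ := entropy_of_ae_const hg.2 hg1 hconst
    simp [entropy, h1, h2]
  have hsub : entropy g P X ≤ (entropyPos g P X : EReal) := by
    have := EReal.sub_le_sub (le_refl (entropyPos g P X : EReal))
      (EReal.coe_ennreal_nonneg (entropyNeg g P X))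
    simpa [entropy] using this
  refine hsub.trans ?_
  unfold Theta
  split_ifs with hc
  · have hm := gHat_bounded_below hg
    have hm0 : -(eVariationOn g (Icc 0 1)).toReal ≤ 0 := by simp
    have hw0 : gHat g 0 = 0 := by simp [gHat, hg1]
    have hw1 : gHat g 1 = 0 := by simp [gHat, hg.2]
    have h0 : convexEnvelope (gHat g) 0 = 0 := le_antisymm
      ((convexEnvelope_le hm (by simp)).trans_eq hw0)
      (le_convexEnvelope_endpoint hm hm0 hw0.ge hw1.ge (Or.inl rfl))
    have h1 : convexEnvelope (gHat g) 1 = 0 := le_antisymm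
      ((convexEnvelope_le hm (by simp)).trans_eq hw1)
      (le_convexEnvelope_endpoint hm hm0 hw0.ge hw1.ge (Or.inr rfl))
    have hle : entropyPos g P X ≤
        ∫⁻ x, ENNReal.ofReal (-convexEnvelope (gHat g) (distFun P X x)) := by
      refine lintegral_mono fun x => ENNReal.ofReal_le_ofReal ?_
      have := convexEnvelope_le hm (v := distFun P X x) ⟨measureReal_nonneg, measureReal_le_one⟩
      rw [gHat] at this
      rw [tailFun_eq P hX.1]
      linarith
    have hfin := hle.trans
      (lintegral_neg_convex_distFun_le (convexOn_convexEnvelope hm) hc h0 h1 hσ hX)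
    refine (EReal.coe_ennreal_le_coe_ennreal_iff.2 hfin).trans_eq ?_
    rw [EReal.coe_ennreal_mul, EReal.coe_ennreal_ofReal, max_eq_left (by positivity)]
  · rw [EReal.coe_mul_top_of_pos (by positivity)]
    exact le_top

end UpperBound

end UnimodalEntropy

end

theorem corollary1 {Ω : Type*} [MeasurableSpace Ω] (P : MeasureTheory.Measure Ω)
    [MeasureTheory.IsProbabilityMeasure P] (hP : UnimodalEntropy.Atomless P)
    (g : ℝ → ℝ) (hg : UnimodalEntropy.IsDistortion g) (hg1 : g 1 = 0)
    (μ σ : ℝ) (hσ : 0 ≤ σ) :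
    (σ : EReal) * UnimodalEntropy.supLambda g ≤ UnimodalEntropy.worstCaseEntropy g P μ σ ∧
      UnimodalEntropy.worstCaseEntropy g P μ σ ≤
        ((σ / 3 : ℝ) : EReal) * UnimodalEntropy.Theta g :=
  ⟨UnimodalEntropy.mul_supLambda_le_worstCaseEntropy hP hg hg1 μ hσ,
    UnimodalEntropy.worstCaseEntropy_le hg hg1 μ hσ⟩
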